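/- **Setting.** Let $L>0$ and let $\mathcal H$ be a summable function on $[0,L]$ whose values are complex $2\times2$ matrices with $\mathcal H(x)\ge 0$ for a.e. $x$; put $J=\begin{pmatrix}0&-1\\1&0\end{pmatrix}$. The pair $(\mathcal H,L)$ is called a canonical system. Its monodromy matrix is $M(z)=M(L,z)$, $z\in\mathbb C$, where $M(\cdot,z)$ is the absolutely continuous matrix solution of $J\,\frac{d}{dx}M(x,z)=z\,\mathcal H(x)M(x,z)$ (a.e. on $[0,L]$) with $M(0,z)=I$. The system has order $\rho$ if $\limsup_{|z|\to\infty}\frac{\log^+\log^+|M_{ik}(z)|}{\log|z|}=\rho$ for all $i,k\in\{1,2\}$, and order at most $\rho$ if these upper limits are all at most $\rho$; here $\log^+t=\max\{0,\log t\}$ for $t>0$ and $\log^+0=0$. The norm $\|\cdot\|$ of a $2\times 2$ matrix is the operator norm on $\mathbb C^2$ with its Hermitian norm. A Hamiltonian $\mathcal G$ on $(0,L)$ has finite rank $N$ with parameters $0=x_0<x_1<\dots<x_N=L$ and unit vectors $e_0,\dots,e_{N-1}\in\mathbb R^2$ if $\mathcal G(x)=P_j:=\langle\cdot,e_j\rangle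 e_j$ for $x\in(x_j,x_{j+1})$, $0\le j\le N-1$. For $d>0$ we say that $(\mathcal H,L)$ satisfies condition $(A_d)$ if there is $C>0$ such that for every sufficiently large $R$ there are a finite rank Hamiltonian $\mathcal H_R$ on $(0,L)$, of some rank $N=N(R)$ and with parameters $x_j,e_j$, and numbers $0<a_j\le1$ $(0\le j\le N-1)$, all depending on $R$, with (i) $\displaystyle\sum_{j=0}^{N-1}\frac1{a_j^2}\int_{x_j}^{x_{j+1}}\|\mathcal H(t)-\mathcal H_R(t)\|\,dt\le C R^{d-1}$; (ii) $\displaystyle\sum_{j=0}^{N-1}a_j^2(x_{j+1}-x_j)\le C R^{d-1}$; (iii) $\displaystyle\sum_{j=0}^{N-2}\log\left(1+\frac{\|P_j-P_{j+1}\|}{a_ja_{j+1}}\right)\le C R^{d}$; (iv) $\displaystyle\log a_0^{-1}+\log a_{N-1}^{-1}+\sum_{j=1}^{N-1}\left|\log\frac{a_j}{a_{j-1}}\right|\le C R^{d}$. **Theorem 1.** 1. Let $(\mathcal H,L)$ be a canonical system, let $0<d<1$, and suppose that $(A_d)$ holds. Then there is $K>0$ such that $\|M(z)\|\le e^{K|z|^d}$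 for all $z\in\mathbb C$. In particular the order of the system is at most $d$. 2. For each $p\in(0,1)$ there is a canonical system, with $\operatorname{tr}\mathcal H(x)=1$ a.e., which has order exactly $p$ and satisfies $(A_{p+\varepsilon})$ for every $\varepsilon>0$. One may take $L=1$ and, with $\alpha=\frac1p-1$ and $b_j=1-j^{-\alpha}$ for $j\ge1$, the diagonal Hamiltonian equal to $\begin{pmatrix}1&0\\0&0\end{pmatrix}$ on $\bigcup_{j\ge1}[b_{2j-1},b_{2j}]$ and to $\begin{pmatrix}0&0\\0&1\end{pmatrix}$ on the rest of $[0,1]$. -/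

import Mathlib

open Set Filter MeasureTheory
open scoped Topology ComplexOrder Matrix.Norms.L2Operator

noncomputable section

namespace CanonicalSystem

/-- Complex `2 × 2` matrices. The norm in force is the operator norm induced by the Hermitian
norm of `ℂ²`. -/
abbrev Mat2 : Type := Matrix (Fin 2) (Fin 2) ℂ

/-- The symplectic matrix `J`. -/
def J : Mat2 := !![0, -1; 1, 0]

/-- `(H, L)` is a canonical system: `L > 0` and `H` is a summable function on `[0, L]` with
nonnegative `2 × 2` matrices as values. -/
structure IsCanonicalSystem (H : ℝ → Mat2) (L : ℝ) : Prop where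
  pos : 0 < L
  integrable : IntegrableOn H (Icc 0 L)
  nonneg : ∀ᵐ x : ℝ, x ∈ Icc 0 L → (H x).PosSemidef

/-- The normalization `tr H = 1` almost everywhere on `[0, L]`. -/
def IsTraceNormed (H : ℝ → Mat2) (L : ℝ) : Prop :=
  ∀ᵐ x : ℝ, x ∈ Icc 0 L → (H x).trace = 1

/-- `M x z` is the monodromy matrix of `(H, L)`: for each `z` the function `M · z` is an absolutely
continuous solution of `J Y' = z H Y` on `[0, L]` (almost everywhere) with `M 0 z = I`. -/
def IsMonodromyMatrix (H : ℝ → Mat2) (L : ℝ) (M : ℝ → ℂ → Mat2) : Prop :=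
  ∀ z : ℂ,
    AbsolutelyContinuousOnInterval (fun x => M x z) 0 L ∧
    M 0 z = 1 ∧
    ∀ᵐ x : ℝ, x ∈ Ioo 0 L →
      DifferentiableAt ℝ (fun t => M t z) x ∧
      J * deriv (fun t => M t z) x = z • (H x * M x z)

/-- The order `limsup_{|z| → ∞} log log |f z| / log |z|` of a function `f : ℂ → ℂ`, as an extended
real number, with `log⁺ = max 0 log` in place of both logarithms of the numerator. -/
def growthOrder (f : ℂ → ℂ) : EReal :=
  limsup (fun z : ℂ => ((Real.posLog (Real.posLog ‖f z‖) / Real.log ‖z‖ : ℝ) : EReal))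
    (Bornology.cobounded ℂ)

/-- The system `(H, L)` has order `ρ`: each of the four entries of its monodromy matrix
`M z = M L z` has order `ρ`. -/
def HasOrder (H : ℝ → Mat2) (L ρ : ℝ) : Prop :=
  ∃ M : ℝ → ℂ → Mat2, IsMonodromyMatrix H L M ∧
    ∀ i k : Fin 2, growthOrder (fun z => M L z i k) = (ρ : EReal)

/-- The operator `⟨·, e⟩ e` on `ℂ²`, for a real vector `e`. -/
def proj (e : EuclideanSpace ℝ (Fin 2)) : Mat2 :=
  Matrix.of fun i k => (e i : ℂ) * (e k : ℂ)

/-- `G` is a Hamiltonian of finite rank on `(0, L)` with rank `N` and parameters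
`0 = x 0 < x 1 < ⋯ < x N = L` and `e 0, …, e (N - 1)`. The values of `x` and `e` at other indices
play no role. -/
structure IsFiniteRank (G : ℝ → Mat2) (L : ℝ) (N : ℕ) (x : ℕ → ℝ)
    (e : ℕ → EuclideanSpace ℝ (Fin 2)) : Prop where
  left : x 0 = 0
  right : x N = L
  lt : ∀ j < N, x j < x (j + 1)
  norm_eq : ∀ j < N, ‖e j‖ = 1
  eq_proj : ∀ j < N, ∀ t ∈ Ioo (x j) (x (j + 1)), G t = proj (e j)

/-- The approximation condition with exponent `d`: there is `C > 0` such that for each large `R`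
there are a Hamiltonian `G` of finite rank and weights `a j ∈ (0, 1]` satisfying the four
bounds. -/
def Approximable (H : ℝ → Mat2) (L d : ℝ) : Prop :=
  ∃ C : ℝ, 0 < C ∧ ∀ᶠ R : ℝ in atTop,
    ∃ (G : ℝ → Mat2) (N : ℕ) (x : ℕ → ℝ) (e : ℕ → EuclideanSpace ℝ (Fin 2)) (a : ℕ → ℝ),
      IsFiniteRank G L N x e ∧
      (∀ j < N, 0 < a j ∧ a j ≤ 1) ∧
      (∑ j ∈ Finset.range N, 1 / a j ^ 2 * ∫ t in x j..x (j + 1), ‖H t - G t‖)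
        ≤ C * R ^ (d - 1) ∧
      (∑ j ∈ Finset.range N, a j ^ 2 * (x (j + 1) - x j)) ≤ C * R ^ (d - 1) ∧
      (∑ j ∈ Finset.range (N - 1),
        Real.log (1 + ‖proj (e j) - proj (e (j + 1))‖ / (a j * a (j + 1)))) ≤ C * R ^ d ∧
      Real.log (a 0)⁻¹ + Real.log (a (N - 1))⁻¹
        + (∑ j ∈ Finset.range (N - 1), |Real.log (a (j + 1) / a j)|) ≤ C * R ^ d

/-- The switching points `b j = 1 - j ^ (-α)`, `j ≥ 1`, with `α = 1 / p - 1`. -/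
def switchPoint (p : ℝ) (j : ℕ) : ℝ := 1 - (j : ℝ) ^ (-(1 / p - 1))

open Classical in
/-- The diagonal Hamiltonian on `[0, 1]` equal to `diag (1, 0)` on the intervals
`[b (2 j - 1), b (2 j)]`, `j ≥ 1`, and to `diag (0, 1)` elsewhere. -/
def switchHamiltonian (p : ℝ) (x : ℝ) : Mat2 :=
  if ∃ j : ℕ, x ∈ Icc (switchPoint p (2 * j + 1)) (switchPoint p (2 * j + 2)) then
    !![1, 0; 0, 0]
  else
    !![0, 0; 0, 1]

end CanonicalSystem

end

/-! Upper bound. On an interval where `H` is close to a rank one projection `P` onto a real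
direction, measure the solution in the basis where the range of `P` is scaled by `a` and its
complement by `a⁻¹`. Since `J` is antisymmetric, `P J P = 0`, so `J P` carries the range of `P` into
the complement and kills the complement; the change of basis therefore multiplies it by `a ^ 2`,
while the error `H - P` grows by at most `a⁻²`. Grönwall's inequality bounds the logarithmic growth
by `|z|` times the corresponding terms of (i) and (ii). Passing from one basis to the next costs a
term of (iii) and a term of (iv); entering the first basis and leaving the last costs the two end
terms of (iv). With `R = |z|` every contribution is at most `C |z| ^ d`
(`norm_monodromyMatrix_le_of_isFiniteRank`).

Sharpness. For the switching Hamiltonian, keep about `R ^ ((1 - d) / α)` intervals and replace the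
tail by a single projection. Each retained switch costs a multiple of `log R`, and `(1 - d) / α < d`
exactly when `d > p`, so the order is at most `p`. Conversely, the solution is an explicit product
of unipotent triangular matrices. On the imaginary axis `z = i y` a diagonal conjugation makes them
nonnegative, with off-diagonal entry `y (b (j + 1) - b j)`, which is at least a multiple of `y j ^
(-1 / p)`. This entry is at least `1` for `j` up to a multiple of `y ^ p`, and each pair of such
factors at least doubles the lower bound for every entry. So all entries grow at least like `2 ^ (c
y ^ p)` (`two_pow_le_norm_entry`). -/

/-! ### Absolutely continuous curves and Grönwall's inequality. -/

theorem AbsolutelyContinuousOnInterval.of_dist_le {X Y : Type*} [PseudoMetricSpace X]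
    [PseudoMetricSpace Y] {f : ℝ → X} {g : ℝ → Y} {a b C : ℝ}
    (hf : AbsolutelyContinuousOnInterval f a b)
    (h : ∀ s ∈ uIcc a b, ∀ t ∈ uIcc a b, dist (g s) (g t) ≤ C * dist (f s) (f t)) :
    AbsolutelyContinuousOnInterval g a b := by
  have h0 := Tendsto.const_mul C hf
  rw [mul_zero] at h0
  refine squeeze_zero' (Eventually.of_forall fun E => Finset.sum_nonneg fun _ _ => dist_nonneg)
    ?_ h0
  filter_upwards [mem_inf_of_right (mem_principal_self _)] with E hE
  rw [Finset.mul_sum]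
  exact Finset.sum_le_sum fun i hi => h _ (hE.1 i hi).1 _ (hE.1 i hi).2

/-- An absolutely continuous function is bounded, and `exp` is Lipschitz on a half-line bounded
above. -/
theorem AbsolutelyContinuousOnInterval.exp_real {f : ℝ → ℝ} {a b : ℝ}
    (hf : AbsolutelyContinuousOnInterval f a b) :
    AbsolutelyContinuousOnInterval (fun x => Real.exp (f x)) a b := by
  obtain ⟨B, hB⟩ := hf.exists_bound
  refine hf.of_dist_le (C := Real.exp B) fun s hs t ht => ?_
  have hconv : Convex ℝ (Iic B) := convex_Iic B
  have := hconv.norm_image_sub_le_of_norm_deriv_le (f := Real.exp) (C := Real.exp B)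
    (fun x _ => Real.differentiableAt_exp)
    (fun x hx => by
      rw [Real.deriv_exp, Real.norm_eq_abs, abs_of_pos (Real.exp_pos x)]
      exact Real.exp_le_exp.2 hx)
    (show f t ∈ Iic B from (le_abs_self _).trans (hB t ht))
    (show f s ∈ Iic B from (le_abs_self _).trans (hB s hs))
  simpa only [dist_eq_norm] using this

/-- The derivative of the norm of a curve is at most the norm of its velocity. -/
theorem HasDerivAt.le_norm_of_norm {E : Type*} [NormedAddCommGroup E] [NormedSpace ℝ E]
    {Y : ℝ → E} {Y' : E} {f' x : ℝ} (hY : HasDerivAt Y Y' x)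
    (hf : HasDerivAt (fun t => ‖Y t‖) f' x) : f' ≤ ‖Y'‖ := by
  refine le_of_tendsto_of_tendsto hf.tendsto_slope hY.tendsto_slope.norm
    (Eventually.of_forall fun t => ?_)
  refine (le_abs_self _).trans ?_
  simp only [slope, vsub_eq_sub, norm_smul, smul_eq_mul, abs_mul, Real.norm_eq_abs]
  gcongr
  exact abs_norm_sub_norm_le _ _

/-- Grönwall's inequality for absolutely continuous curves. -/
theorem AbsolutelyContinuousOnInterval.norm_le_mul_exp {E : Type*} [NormedAddCommGroup E]
    [NormedSpace ℝ E] {Y : ℝ → E} {k : ℝ → ℝ} {a b : ℝ} (hab : a ≤ b)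
    (hY : AbsolutelyContinuousOnInterval Y a b) (hk : IntervalIntegrable k volume a b)
    (h : ∀ᵐ x, x ∈ Ioo a b → ∃ Y', HasDerivAt Y Y' x ∧ ‖Y'‖ ≤ k x * ‖Y x‖) :
    ‖Y b‖ ≤ ‖Y a‖ * Real.exp (∫ x in a..b, k x) := by
  have hf : AbsolutelyContinuousOnInterval (fun x => ‖Y x‖) a b :=
    hY.of_dist_le (C := 1) fun s _ t _ => by
      simpa [dist_eq_norm] using dist_norm_norm_le (Y s) (Y t)
  have hK := hk.absolutelyContinuousOnInterval_intervalIntegral (c := a) left_mem_uIcc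
  have hg := hf.fun_mul hK.fun_neg.exp_real
  -- The norm need not be differentiable along `Y` everywhere, but `‖Y‖ exp (-∫ k)` is absolutely
  -- continuous: its derivative exists almost everywhere, is nonpositive, and integrates back to the
  -- increment.
  have hle : ∫ x in a..b, deriv (fun x => ‖Y x‖ * Real.exp (-∫ t in a..x, k t)) x ≤
      ∫ x in a..b, (0 : ℝ) := by
    refine intervalIntegral.integral_mono_ae_restrict hab hg.intervalIntegrable_deriv
      intervalIntegrable_const ?_ |>.trans_eq rfl
    have ha : ∀ᵐ x : ℝ, x ≠ a := by simp [ae_iff, measure_singleton]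
    have hb : ∀ᵐ x : ℝ, x ≠ b := by simp [ae_iff, measure_singleton]
    rw [EventuallyLE, ae_restrict_iff' measurableSet_Icc]
    filter_upwards [h, hf.ae_differentiableAt, hk.ae_hasDerivAt_integral, ha, hb]
      with x h1 h2 h3 hxa hxb hx
    obtain ⟨Y', hY', hle⟩ := h1 ⟨lt_of_le_of_ne hx.1 (Ne.symm hxa), lt_of_le_of_ne hx.2 hxb⟩
    have hxu : x ∈ uIcc a b := by rwa [uIcc_of_le hab]
    have hf' := (h2 hxu).hasDerivAt
    have hd := hf'.mul (h3 hxu a left_mem_uIcc).neg.exp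
    have hle' := (hY'.le_norm_of_norm hf').trans hle
    refine (HasDerivAt.deriv hd).trans_le ?_
    have he := Real.exp_pos (-∫ t in a..x, k t)
    have := mul_le_mul_of_nonneg_right hle' he.le
    simp only [Pi.neg_apply]
    linarith
  rw [hg.integral_deriv_eq_sub, intervalIntegral.integral_zero] at hle
  simp only [intervalIntegral.integral_same, neg_zero, Real.exp_zero, mul_one] at hle
  have he := Real.exp_pos (∫ t in a..b, k t)
  rw [Real.exp_neg] at hle
  have h2 : ‖Y b‖ * (Real.exp (∫ t in a..b, k t))⁻¹ ≤ ‖Y a‖ := by linarith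
  rwa [← div_eq_mul_inv, div_le_iff₀ he] at h2

/-! ### Rank one projections and rescaled bases. -/

namespace CanonicalSystem

theorem star_proj (e : EuclideanSpace ℝ (Fin 2)) : star (proj e) = proj e := by
  ext i k
  simp [proj, Matrix.star_apply, mul_comm]

theorem proj_mul_proj {e : EuclideanSpace ℝ (Fin 2)} (he : ‖e‖ = 1) :
    proj e * proj e = proj e := by
  have h : (e 0 : ℂ) * e 0 + e 1 * e 1 = 1 := by
    rw [EuclideanSpace.norm_eq, Real.sqrt_eq_one, Fin.sum_univ_two] at he
    simp only [Real.norm_eq_abs, sq_abs] at he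
    rw [← Complex.ofReal_mul, ← Complex.ofReal_mul, ← Complex.ofReal_add,
      show e 0 * e 0 + e 1 * e 1 = (1 : ℝ) by linarith, Complex.ofReal_one]
  ext i k
  simp only [proj, Matrix.mul_apply, Fin.sum_univ_two, Matrix.of_apply]
  linear_combination ((e i : ℂ) * e k) * h

/-- For real `e` the antisymmetry of `J` gives `eᵀ J e = 0`; this cancellation makes the rescaling
profitable. -/
theorem proj_mul_J_mul_proj (e : EuclideanSpace ℝ (Fin 2)) : proj e * J * proj e = 0 := by
  ext i k
  simp [proj, J, Matrix.mul_apply, Fin.sum_univ_two]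
  ring

theorem J_mul_J : J * J = -1 := by
  ext i k
  fin_cases i <;> fin_cases k <;> simp [J]

theorem norm_le_one_of_star_mul_self {U : Mat2} (h : star U * U = 1) : ‖U‖ ≤ 1 := by
  have h1 := CStarRing.norm_star_mul_self (x := U)
  rw [h, CStarRing.norm_one] at h1
  nlinarith [norm_nonneg U]

theorem norm_J_le : ‖J‖ ≤ 1 := by
  refine norm_le_one_of_star_mul_self ?_
  ext i k
  fin_cases i <;> fin_cases k <;> simp [J, Matrix.star_eq_conjTranspose, Matrix.mul_apply]

/-- The matrix is the mean of `α` and `β` times `1` plus half their difference times the unitary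
reflection `2 P - 1`. -/
theorem norm_smul_add_smul_le {P : Mat2} (hs : star P = P) (hP : P * P = P) {α β c : ℝ}
    (hα : 0 ≤ α) (hβ : 0 ≤ β) (hαc : α ≤ c) (hβc : β ≤ c) :
    ‖α • P + β • (1 - P)‖ ≤ c := by
  have hU : ‖(2 : ℝ) • P - 1‖ ≤ 1 := by
    refine norm_le_one_of_star_mul_self ?_
    have : star ((2 : ℝ) • P - 1) = (2 : ℝ) • P - 1 := by simp [hs]
    rw [this]
    simp only [mul_sub, sub_mul, smul_mul_assoc, mul_smul_comm, hP, mul_one, one_mul]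
    module
  have h : α • P + β • (1 - P) = ((α + β) / 2) • (1 : Mat2) + ((α - β) / 2) • ((2 : ℝ) • P - 1) := by
    module
  rw [h]
  refine (norm_add_le _ _).trans ?_
  rw [norm_smul, norm_smul, CStarRing.norm_one, Real.norm_eq_abs, Real.norm_eq_abs, mul_one,
    abs_of_nonneg (by positivity)]
  have h2 : |(α - β) / 2| * ‖(2 : ℝ) • P - 1‖ ≤ |(α - β) / 2| * 1 := by gcongr
  rcases abs_cases ((α - β) / 2) with h3 | h3 <;> linarith

/-- The matrix acting as `a` on the range of `P` and as `a⁻¹` on its orthogonal complement. -/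
noncomputable def scaling (a : ℝ) (P : Mat2) : Mat2 := a • P + a⁻¹ • (1 - P)

theorem scaling_mul_scaling {P : Mat2} (hP : P * P = P) (a b : ℝ) :
    scaling a P * scaling b P = scaling (a * b) P := by
  simp only [scaling, mul_sub, sub_mul, smul_mul_assoc, mul_smul_comm, hP, mul_one, one_mul,
    mul_add, add_mul, mul_inv]
  module

theorem scaling_one (P : Mat2) : scaling 1 P = 1 := by
  simp [scaling]

theorem norm_scaling_le {P : Mat2} (hs : star P = P) (hP : P * P = P) {a c : ℝ} (ha : 0 < a)
    (h1 : a ≤ c) (h2 : a⁻¹ ≤ c) : ‖scaling a P‖ ≤ c :=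
  norm_smul_add_smul_le hs hP ha.le (inv_pos.2 ha).le h1 h2

theorem norm_scaling_le_exp {P : Mat2} (hs : star P = P) (hP : P * P = P) {a : ℝ} (ha : 0 < a) :
    ‖scaling a P‖ ≤ Real.exp |Real.log a| := by
  refine norm_scaling_le hs hP ha ?_ ?_
  · conv_lhs => rw [← Real.exp_log ha]
    exact Real.exp_le_exp.2 (le_abs_self _)
  · conv_lhs => rw [← Real.exp_log (inv_pos.2 ha), Real.log_inv]
    exact Real.exp_le_exp.2 (neg_le_abs _)

theorem norm_projection_le {P : Mat2} (hs : star P = P) (hP : P * P = P) : ‖P‖ ≤ 1 := by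
  simpa using norm_smul_add_smul_le hs hP (α := 1) (β := 0) (c := 1) (by simp) (by simp)
    (by simp) (by simp)

/-- After rescaling, the rank one part of the coefficient becomes small. -/
theorem norm_scaling_conj_le {P : Mat2} (hs : star P = P) (hP : P * P = P)
    (hJ : P * J * P = 0) {a : ℝ} (ha : 0 < a) (ha1 : a ≤ 1) (H : Mat2) :
    ‖scaling a⁻¹ P * (J * H) * scaling a P‖ ≤ a ^ 2 + 1 / a ^ 2 * ‖H - P‖ := by
  have hinv : 1 ≤ a⁻¹ := (one_le_inv₀ ha).2 ha1
  -- One factor `a` comes from the right, where `P` selects its own eigenvalue. The other comes from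
  -- the left: `P J P = 0` puts `J P` in the complement, where `scaling a⁻¹ P` acts as `a`.
  have h1 : scaling a⁻¹ P * (J * P) * scaling a P = (a ^ 2) • (J * P) := by
    have e1 : P * scaling a P = a • P := by
      simp only [scaling, mul_add, mul_smul_comm, mul_sub, mul_one, hP, sub_self, smul_zero,
        add_zero]
    have e2 : scaling a⁻¹ P * (J * P) = a • (J * P) := by
      have : P * (J * P) = 0 := by rw [← mul_assoc, hJ]
      simp only [scaling, add_mul, smul_mul_assoc, sub_mul, one_mul, this, smul_zero, sub_zero,
        zero_add, inv_inv]
    rw [e2, smul_mul_assoc, mul_assoc, e1, mul_smul_comm, smul_smul, sq]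
  have h2 : scaling a⁻¹ P * (J * H) * scaling a P =
      (a ^ 2) • (J * P) + scaling a⁻¹ P * (J * (H - P)) * scaling a P := by
    rw [← h1]; noncomm_ring
  have hS : ‖scaling a⁻¹ P‖ ≤ a⁻¹ :=
    norm_scaling_le hs hP (inv_pos.2 ha) le_rfl (by rw [inv_inv]; linarith)
  have hT : ‖scaling a P‖ ≤ a⁻¹ := norm_scaling_le hs hP ha (by linarith) le_rfl
  have hJP : ‖J * P‖ ≤ 1 :=
    (norm_mul_le _ _).trans (mul_le_one₀ norm_J_le (norm_nonneg _) (norm_projection_le hs hP))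
  rw [h2]
  refine (norm_add_le _ _).trans (add_le_add ?_ ?_)
  · rw [norm_smul, Real.norm_eq_abs, abs_of_nonneg (sq_nonneg a)]
    exact mul_le_of_le_one_right (sq_nonneg a) hJP
  · have hJH : ‖J * (H - P)‖ ≤ ‖H - P‖ :=
      (norm_mul_le _ _).trans (mul_le_of_le_one_left (norm_nonneg _) norm_J_le)
    calc ‖scaling a⁻¹ P * (J * (H - P)) * scaling a P‖
        ≤ ‖scaling a⁻¹ P‖ * ‖J * (H - P)‖ * ‖scaling a P‖ :=
          (norm_mul_le _ _).trans (by gcongr; exact norm_mul_le _ _)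
      _ ≤ a⁻¹ * ‖H - P‖ * a⁻¹ := by gcongr
      _ = 1 / a ^ 2 * ‖H - P‖ := by ring

/-- The cost of passing from one scaling to the next. -/
theorem norm_scaling_transition_le {P Q : Mat2} (hsP : star P = P) (hP : P * P = P) {a b : ℝ}
    (ha : 0 < a) (ha1 : a ≤ 1) (hb : 0 < b) (hb1 : b ≤ 1) :
    ‖scaling b⁻¹ Q * scaling a P‖ ≤
      Real.exp |Real.log (b / a)| * (1 + ‖P - Q‖ / (a * b)) := by
  -- Replacing `Q` by `P` in the left factor merges the two scalings; the error is a multiple of `Q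
  -- - P`.
  have h1 : scaling b⁻¹ Q * scaling a P =
      scaling (b⁻¹ * a) P + (b⁻¹ - b) • ((Q - P) * scaling a P) := by
    have : scaling b⁻¹ Q = scaling b⁻¹ P + (b⁻¹ - b) • (Q - P) := by
      simp only [scaling, inv_inv]; module
    rw [this, add_mul, scaling_mul_scaling hP, smul_mul_assoc]
  have hbinv : 1 ≤ b⁻¹ := (one_le_inv₀ hb).2 hb1
  have hainv : 1 ≤ a⁻¹ := (one_le_inv₀ ha).2 ha1
  have h2 : ‖scaling (b⁻¹ * a) P‖ ≤ Real.exp |Real.log (b / a)| := by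
    refine (norm_scaling_le_exp hsP hP (by positivity)).trans_eq ?_
    rw [show b⁻¹ * a = (b / a)⁻¹ by field_simp, Real.log_inv, abs_neg]
  have h3 : ‖(b⁻¹ - b) • ((Q - P) * scaling a P)‖ ≤ ‖P - Q‖ / (a * b) := by
    rw [norm_smul, Real.norm_eq_abs, abs_of_nonneg (by linarith)]
    calc (b⁻¹ - b) * ‖(Q - P) * scaling a P‖ ≤ b⁻¹ * (‖Q - P‖ * a⁻¹) := by
          gcongr
          · linarith
          · refine (norm_mul_le _ _).trans ?_
            gcongr
            exact norm_scaling_le hsP hP ha (by linarith) le_rfl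
      _ = ‖P - Q‖ / (a * b) := by rw [norm_sub_rev]; field_simp
  have h4 : 1 ≤ Real.exp |Real.log (b / a)| := Real.one_le_exp (abs_nonneg _)
  have h5 : 0 ≤ ‖P - Q‖ / (a * b) := by positivity
  rw [h1]
  refine (norm_add_le _ _).trans ?_
  nlinarith

/-! ### Growth of the monodromy matrix under the approximation condition. -/

theorem IsMonodromyMatrix.ae_hasDerivAt {H : ℝ → Mat2} {L : ℝ} {M : ℝ → ℂ → Mat2}
    (hM : IsMonodromyMatrix H L M) (z : ℂ) :
    ∀ᵐ x : ℝ, x ∈ Ioo 0 L →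
      HasDerivAt (fun t => M t z) (-(z • (J * (H x * M x z)))) x := by
  filter_upwards [(hM z).2.2] with x hx hx0
  obtain ⟨hd, he⟩ := hx hx0
  have : deriv (fun t => M t z) x = -(z • (J * (H x * M x z))) := by
    rw [← mul_smul_comm, ← he, ← mul_assoc, J_mul_J, neg_one_mul, neg_neg]
  rw [← this]
  exact hd.hasDerivAt

/-- Growth of a solution over a subinterval, measured in a fixed change of basis. -/
theorem IsMonodromyMatrix.norm_mul_le {H : ℝ → Mat2} {L : ℝ} {M : ℝ → ℂ → Mat2}
    (hM : IsMonodromyMatrix H L M) (z : ℂ) {s t : ℝ} (hs : 0 ≤ s) (hst : s ≤ t) (ht : t ≤ L)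
    {S T : Mat2} (hTS : T * S = 1) {k : ℝ → ℝ} (hk : IntervalIntegrable k volume s t)
    (hle : ∀ x ∈ Ioo s t, ‖S * (J * H x) * T‖ ≤ k x) :
    ‖S * M t z‖ ≤ ‖S * M s z‖ * Real.exp (‖z‖ * ∫ x in s..t, k x) := by
  have hsub : uIcc s t ⊆ uIcc 0 L := by
    rw [uIcc_of_le hst, uIcc_of_le (hs.trans (hst.trans ht))]
    exact Icc_subset_Icc hs ht
  have hac : AbsolutelyContinuousOnInterval (fun x => S * M x z) s t :=
    ((hM z).1.mono hsub).of_dist_le (C := ‖S‖) fun x _ y _ => by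
      rw [dist_eq_norm, dist_eq_norm, ← mul_sub]
      exact _root_.norm_mul_le _ _
  rw [← intervalIntegral.integral_const_mul]
  refine hac.norm_le_mul_exp hst (hk.const_mul _) ?_
  filter_upwards [hM.ae_hasDerivAt z] with x hx hxst
  have hd := hx ⟨hs.trans_lt hxst.1, hxst.2.trans_le ht⟩
  refine ⟨_, hd.const_mul S, ?_⟩
  have : S * -(z • (J * (H x * M x z))) = -(z • ((S * (J * H x) * T) * (S * M x z))) := by
    have e : (S * (J * H x) * T) * (S * M x z) = S * (J * H x) * (T * S) * M x z := by
      noncomm_ring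
    rw [e, hTS, mul_neg, mul_smul_comm]
    noncomm_ring
  rw [this, norm_neg, norm_smul, mul_assoc ‖z‖]
  exact mul_le_mul_of_nonneg_left ((_root_.norm_mul_le _ _).trans
    (mul_le_mul_of_nonneg_right (hle x hxst) (norm_nonneg _))) (norm_nonneg z)

theorem IsCanonicalSystem.intervalIntegrable {H : ℝ → Mat2} {L : ℝ} (hH : IsCanonicalSystem H L)
    {s t : ℝ} (hs : 0 ≤ s) (hst : s ≤ t) (ht : t ≤ L) : IntervalIntegrable H volume s t := by
  rw [intervalIntegrable_iff_integrableOn_Icc_of_le hst]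
  exact hH.integrable.mono_set (Icc_subset_Icc hs ht)

/-- The bound without rescaling; it serves the bounded set of `z` where `|z|` is too small for the
approximation condition. -/
theorem norm_monodromyMatrix_le {H : ℝ → Mat2} {L : ℝ} {M : ℝ → ℂ → Mat2}
    (hH : IsCanonicalSystem H L) (hM : IsMonodromyMatrix H L M) (z : ℂ) :
    ‖M L z‖ ≤ Real.exp (‖z‖ * ∫ x in 0..L, ‖H x‖) := by
  have := hM.norm_mul_le z le_rfl hH.pos.le le_rfl (S := 1) (T := 1) (one_mul 1)
    (hH.intervalIntegrable le_rfl hH.pos.le le_rfl).norm (fun x _ => by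
      rw [one_mul, mul_one]
      exact (_root_.norm_mul_le _ _).trans (mul_le_of_le_one_left (norm_nonneg _) norm_J_le))
  simpa [(hM z).2.1, CStarRing.norm_one] using this

theorem IsFiniteRank.mem_Icc {G : ℝ → Mat2} {L : ℝ} {N : ℕ} {x : ℕ → ℝ}
    {e : ℕ → EuclideanSpace ℝ (Fin 2)} (h : IsFiniteRank G L N x e) {j : ℕ} (hj : j ≤ N) :
    x j ∈ Icc 0 L := by
  constructor
  · induction j with
    | zero => exact h.left.ge
    | succ j ih => exact (ih (by omega)).trans (h.lt j (by omega)).le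
  · rw [← h.right]
    induction hj using Nat.decreasingInduction with
    | self => exact le_rfl
    | of_succ k hk ih => exact (h.lt k hk).le.trans ih

/-- The growth of the monodromy matrix in terms of an approximating Hamiltonian of finite rank
and a choice of weights. -/
theorem norm_monodromyMatrix_le_of_isFiniteRank {H G : ℝ → Mat2} {L : ℝ} {M : ℝ → ℂ → Mat2}
    (hH : IsCanonicalSystem H L) (hM : IsMonodromyMatrix H L M) {n : ℕ} {x a : ℕ → ℝ}
    {e : ℕ → EuclideanSpace ℝ (Fin 2)} (hG : IsFiniteRank G L (n + 1) x e)
    (ha : ∀ j < n + 1, 0 < a j ∧ a j ≤ 1) (z : ℂ) :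
    ‖M L z‖ ≤ Real.exp (
      ‖z‖ * (∑ j ∈ Finset.range (n + 1), a j ^ 2 * (x (j + 1) - x j)) +
      ‖z‖ * (∑ j ∈ Finset.range (n + 1), 1 / a j ^ 2 * ∫ t in x j..x (j + 1), ‖H t - G t‖) +
      (∑ j ∈ Finset.range n,
        Real.log (1 + ‖proj (e j) - proj (e (j + 1))‖ / (a j * a (j + 1)))) +
      (Real.log (a 0)⁻¹ + Real.log (a n)⁻¹ +
        ∑ j ∈ Finset.range n, |Real.log (a (j + 1) / a j)|)) := by
  have hs : ∀ j, star (proj (e j)) = proj (e j) := fun j => star_proj _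
  have hP : ∀ j < n + 1, proj (e j) * proj (e j) = proj (e j) :=
    fun j hj => proj_mul_proj (hG.norm_eq j hj)
  have step : ∀ j < n + 1, ‖scaling (a j)⁻¹ (proj (e j)) * M (x (j + 1)) z‖ ≤
      ‖scaling (a j)⁻¹ (proj (e j)) * M (x j) z‖ *
        Real.exp (‖z‖ * (a j ^ 2 * (x (j + 1) - x j)) +
          ‖z‖ * (1 / a j ^ 2 * ∫ t in x j..x (j + 1), ‖H t - G t‖)) := by
    intro j hj
    have h0 := hG.mem_Icc (j := j) (by omega)
    have h1 := hG.mem_Icc (j := j + 1) (by omega)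
    have hlt := (hG.lt j hj).le
    have hTS : scaling (a j) (proj (e j)) * scaling (a j)⁻¹ (proj (e j)) = 1 := by
      rw [scaling_mul_scaling (hP j hj), mul_inv_cancel₀ (ha j hj).1.ne', scaling_one]
    have hint : IntervalIntegrable (fun t => ‖H t - proj (e j)‖) volume (x j) (x (j + 1)) :=
      ((hH.intervalIntegrable h0.1 hlt h1.2).sub intervalIntegrable_const).norm
    have hGe : ∫ t in x j..x (j + 1), ‖H t - G t‖ =
        ∫ t in x j..x (j + 1), ‖H t - proj (e j)‖ := by
      refine intervalIntegral.integral_congr_uIoo fun t ht => ?_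
      rw [uIoo_of_le hlt] at ht
      simp only [hG.eq_proj j hj t ht]
    have := hM.norm_mul_le z h0.1 hlt h1.2 hTS
      (intervalIntegrable_const.add (hint.const_mul (1 / a j ^ 2)))
      (fun t _ => norm_scaling_conj_le (hs j) (hP j hj) (proj_mul_J_mul_proj (e j))
        (ha j hj).1 (ha j hj).2 (H t))
    rwa [intervalIntegral.integral_add intervalIntegrable_const (hint.const_mul _),
      intervalIntegral.integral_const, intervalIntegral.integral_const_mul, smul_eq_mul,
      ← hGe, mul_add, mul_comm (x (j + 1) - x j)] at this
  -- The induction stays in the basis of the current interval, so the factor `(a n)⁻¹` for leaving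
  -- it is paid once, at the end.
  have key : ∀ j < n + 1, ‖scaling (a j)⁻¹ (proj (e j)) * M (x (j + 1)) z‖ ≤ Real.exp (
      ‖z‖ * (∑ i ∈ Finset.range (j + 1), a i ^ 2 * (x (i + 1) - x i)) +
      ‖z‖ * (∑ i ∈ Finset.range (j + 1), 1 / a i ^ 2 * ∫ t in x i..x (i + 1), ‖H t - G t‖) +
      (∑ i ∈ Finset.range j,
        Real.log (1 + ‖proj (e i) - proj (e (i + 1))‖ / (a i * a (i + 1)))) +
      (Real.log (a 0)⁻¹ + ∑ i ∈ Finset.range j, |Real.log (a (i + 1) / a i)|)) := by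
    intro j
    induction j with
    | zero =>
      intro hj
      obtain ⟨ha0, ha1⟩ := ha 0 hj
      have hinv : 1 ≤ (a 0)⁻¹ := (one_le_inv₀ ha0).2 ha1
      have h0 : ‖scaling (a 0)⁻¹ (proj (e 0))‖ ≤ (a 0)⁻¹ :=
        norm_scaling_le (hs 0) (hP 0 hj) (inv_pos.2 ha0) le_rfl (by rw [inv_inv]; linarith)
      have h := step 0 hj
      rw [hG.left, (hM z).2.1, mul_one] at h
      rw [zero_add, Finset.sum_range_one, Finset.sum_range_one, Finset.sum_range_zero,
        Finset.sum_range_zero, add_zero, add_zero, Real.exp_add _ (Real.log (a 0)⁻¹),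
        Real.exp_log (by positivity), mul_comm (Real.exp _), hG.left]
      exact h.trans (by gcongr)
    | succ j ih =>
      intro hj
      have hj' : j < n + 1 := by omega
      obtain ⟨ha0, ha1⟩ := ha j hj'
      obtain ⟨hb0, hb1⟩ := ha (j + 1) hj
      have hST : scaling (a j) (proj (e j)) * scaling (a j)⁻¹ (proj (e j)) = 1 := by
        rw [scaling_mul_scaling (hP j hj'), mul_inv_cancel₀ ha0.ne', scaling_one]
      have htr : ‖scaling (a (j + 1))⁻¹ (proj (e (j + 1))) * M (x (j + 1)) z‖ ≤
          Real.exp |Real.log (a (j + 1) / a j)| *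
            (1 + ‖proj (e j) - proj (e (j + 1))‖ / (a j * a (j + 1))) *
          ‖scaling (a j)⁻¹ (proj (e j)) * M (x (j + 1)) z‖ := by
        have e1 : scaling (a (j + 1))⁻¹ (proj (e (j + 1))) * M (x (j + 1)) z =
            (scaling (a (j + 1))⁻¹ (proj (e (j + 1))) * scaling (a j) (proj (e j))) *
              (scaling (a j)⁻¹ (proj (e j)) * M (x (j + 1)) z) := by
          rw [mul_assoc, ← mul_assoc (scaling (a j) (proj (e j))), hST, one_mul]
        rw [e1]
        refine (_root_.norm_mul_le _ _).trans ?_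
        gcongr
        exact norm_scaling_transition_le (hs j) (hP j hj') ha0 ha1 hb0 hb1
      have hpos : 0 < 1 + ‖proj (e j) - proj (e (j + 1))‖ / (a j * a (j + 1)) := by positivity
      refine (step (j + 1) hj).trans ?_
      have := htr.trans (mul_le_mul_of_nonneg_left (ih hj') (by positivity))
      refine (mul_le_mul_of_nonneg_right this (Real.exp_pos _).le).trans_eq ?_
      rw [Finset.sum_range_succ _ (j + 1), Finset.sum_range_succ _ (j + 1),
        Finset.sum_range_succ (fun i =>
          Real.log (1 + ‖proj (e i) - proj (e (i + 1))‖ / (a i * a (i + 1)))) j,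
        Finset.sum_range_succ (fun i => |Real.log (a (i + 1) / a i)|) j]
      conv_lhs => rw [← Real.exp_log hpos]
      rw [← Real.exp_add, ← Real.exp_add, ← Real.exp_add]
      congr 1
      ring
  have hn : n < n + 1 := by omega
  obtain ⟨ha0, ha1⟩ := ha n hn
  have hinv : 1 ≤ (a n)⁻¹ := (one_le_inv₀ ha0).2 ha1
  have hfin : M L z = scaling (a n) (proj (e n)) *
      (scaling (a n)⁻¹ (proj (e n)) * M (x (n + 1)) z) := by
    rw [← mul_assoc, scaling_mul_scaling (hP n hn), mul_inv_cancel₀ ha0.ne', scaling_one, one_mul,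
      hG.right]
  have hT : ‖scaling (a n) (proj (e n))‖ ≤ (a n)⁻¹ :=
    norm_scaling_le (hs n) (hP n hn) ha0 (by linarith) le_rfl
  rw [hfin]
  refine (_root_.norm_mul_le _ _).trans
    ((mul_le_mul hT (key n hn) (norm_nonneg _) (by positivity)).trans_eq ?_)
  conv_lhs => rw [← Real.exp_log (inv_pos.2 ha0)]
  rw [← Real.exp_add]
  congr 1
  ring

theorem Approximable.exists_norm_monodromyMatrix_le {H : ℝ → Mat2} {L d : ℝ}
    (hH : IsCanonicalSystem H L) (hd1 : d < 1) (hA : Approximable H L d)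
    {M : ℝ → ℂ → Mat2} (hM : IsMonodromyMatrix H L M) :
    ∃ K : ℝ, 0 < K ∧ ∀ z : ℂ, ‖M L z‖ ≤ Real.exp (K * ‖z‖ ^ d) := by
  obtain ⟨C, hC, hev⟩ := hA
  obtain ⟨R₀, hR₀⟩ := eventually_atTop.1 hev
  set r := max R₀ 1 with hr
  have hr1 : 1 ≤ r := le_max_right _ _
  have hI : 0 ≤ ∫ x in 0..L, ‖H x‖ :=
    intervalIntegral.integral_nonneg hH.pos.le fun _ _ => norm_nonneg _
  -- For `|z| ≥ r` each of the four conditions contributes `C`; for `|z| ≤ r` the crude bound is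
  -- used with `|z| ≤ r ^ (1 - d) |z| ^ d`.
  refine ⟨4 * C + r ^ (1 - d) * ∫ x in 0..L, ‖H x‖, by positivity, fun z => ?_⟩
  rcases le_total r ‖z‖ with hz | hz
  · have hz0 : 0 < ‖z‖ := by linarith
    obtain ⟨G, N, x, e, a, hG, ha, h1, h2, h3, h4⟩ := hR₀ ‖z‖ ((le_max_left _ _).trans hz)
    obtain _ | n := N
    · exact absurd (hG.left.symm.trans hG.right) hH.pos.ne
    rw [Nat.add_sub_cancel] at h3 h4
    refine (norm_monodromyMatrix_le_of_isFiniteRank hH hM hG ha z).trans (Real.exp_le_exp.2 ?_)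
    have hpow : ‖z‖ * (C * ‖z‖ ^ (d - 1)) = C * ‖z‖ ^ d := by
      rw [Real.rpow_sub_one hz0.ne']; field_simp
    have h1' := mul_le_mul_of_nonneg_left h1 hz0.le
    have h2' := mul_le_mul_of_nonneg_left h2 hz0.le
    rw [hpow] at h1' h2'
    have h5 : 0 ≤ (r ^ (1 - d) * ∫ x in 0..L, ‖H x‖) * ‖z‖ ^ d := by positivity
    linarith
  · refine (norm_monodromyMatrix_le hH hM z).trans (Real.exp_le_exp.2 ?_)
    have hle : ‖z‖ ≤ r ^ (1 - d) * ‖z‖ ^ d := by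
      rcases (norm_nonneg z).eq_or_lt with h0 | h0
      · rw [← h0]; positivity
      · calc ‖z‖ = ‖z‖ ^ (1 - d) * ‖z‖ ^ d := by
              rw [← Real.rpow_add h0, sub_add_cancel, Real.rpow_one]
          _ ≤ r ^ (1 - d) * ‖z‖ ^ d := by
              gcongr
    have h6 : 0 ≤ 4 * C * ‖z‖ ^ d := by positivity
    have := mul_le_mul_of_nonneg_right hle hI
    linarith

theorem growthOrder_le_of_norm_le {f : ℂ → ℂ} {K d : ℝ} (hK : 0 < K) (hd : 0 < d)
    (hf : ∀ z, ‖f z‖ ≤ Real.exp (K * ‖z‖ ^ d)) : growthOrder f ≤ (d : EReal) := by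
  have hlog : Tendsto (fun z : ℂ => Real.log ‖z‖) (Bornology.cobounded ℂ) atTop :=
    Real.tendsto_log_atTop.comp tendsto_norm_cobounded_atTop
  -- Taking logarithms of `K |z| ^ d` leaves this majorant; the absolute value keeps it nonnegative,
  -- as the truncation in `log⁺` demands.
  have hlim : Tendsto (fun z : ℂ => ((|Real.log K| / Real.log ‖z‖ + d : ℝ) : EReal))
      (Bornology.cobounded ℂ) (𝓝 (d : EReal)) := by
    refine (continuous_coe_real_ereal.tendsto d).comp ?_
    simpa using (hlog.const_div_atTop |Real.log K|).add_const d
  rw [growthOrder, ← hlim.limsup_eq]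
  refine limsup_le_limsup ?_
  filter_upwards [hlog.eventually_gt_atTop 0] with z hz
  rw [EReal.coe_le_coe_iff, div_add' _ _ _ hz.ne']
  refine div_le_div_of_nonneg_right ?_ hz.le
  have hz1 : 1 < ‖z‖ := (Real.log_pos_iff (norm_nonneg z)).1 hz
  have hz0 : 0 < ‖z‖ := by linarith
  have hKz : 0 < K * ‖z‖ ^ d := by positivity
  have h1 : Real.posLog ‖f z‖ ≤ K * ‖z‖ ^ d := by
    refine (Real.posLog_le_posLog (norm_nonneg _) (hf z)).trans_eq ?_
    simp only [Real.posLog_apply]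
    rw [Real.log_exp, max_eq_right hKz.le]
  refine (Real.posLog_le_posLog Real.posLog_nonneg h1).trans ?_
  simp only [Real.posLog_apply]
  rw [Real.log_mul hK.ne' (by positivity), Real.log_rpow hz0]
  refine max_le (by positivity) ?_
  linarith [le_abs_self (Real.log K)]

theorem norm_entry_le_l2 (A : Mat2) (i k : Fin 2) : ‖A i k‖ ≤ ‖A‖ := by
  have h := Matrix.l2_opNorm_mulVec A (EuclideanSpace.single k 1)
  have h1 : A i k = (WithLp.toLp 2 (A.mulVec (EuclideanSpace.single k (1 : ℂ)).ofLp) :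
      EuclideanSpace ℂ (Fin 2)) i := by
    simp
  rw [PiLp.norm_single, norm_one, mul_one] at h
  rw [h1]
  exact (PiLp.norm_apply_le _ i).trans h

theorem Approximable.growthOrder_le {H : ℝ → Mat2} {L d : ℝ}
    (hH : IsCanonicalSystem H L) (hd : 0 < d) (hd1 : d < 1) (hA : Approximable H L d)
    {M : ℝ → ℂ → Mat2} (hM : IsMonodromyMatrix H L M) (i k : Fin 2) :
    growthOrder (fun z => M L z i k) ≤ (d : EReal) := by
  obtain ⟨K, hK, h⟩ := hA.exists_norm_monodromyMatrix_le hH hd1 hM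
  exact growthOrder_le_of_norm_le hK hd fun z => (norm_entry_le_l2 _ i k).trans (h z)

end CanonicalSystem

/-! ### Volterra equations with bounded coefficient. -/

section Volterra

theorem intervalIntegrable_of_norm_le_const {E : Type*} [NormedAddCommGroup E] {A : ℝ → E}
    (hA : AEStronglyMeasurable A volume) {K : ℝ} (hK : ∀ x, ‖A x‖ ≤ K) (a b : ℝ) : IntervalIntegrable A volume a b :=
  (intervalIntegrable_const (c := K)).mono_fun' hA.restrict (ae_of_all _ hK)

theorem intervalIntegrable_mul_of_continuousOn {𝔸 : Type*} [NormedRing 𝔸] {A Y : ℝ → 𝔸}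
    (hA : AEStronglyMeasurable A volume) {K L : ℝ} (hK : ∀ x, ‖A x‖ ≤ K)
    (hY : ContinuousOn Y (Icc 0 L)) {s t : ℝ} (hs : s ∈ Icc 0 L) (ht : t ∈ Icc 0 L) :
    IntervalIntegrable (fun x => A x * Y x) volume s t :=
  (intervalIntegrable_of_norm_le_const hA hK s t).mul_continuousOn
    (hY.mono (uIcc_subset_Icc hs ht))

variable {𝔸 : Type*} [NormedRing 𝔸] [NormedAlgebra ℝ 𝔸]

/-- The terms of the Neumann series of the Volterra equation `Y x = 1 + ∫ t in 0..x, A t * Y t`. -/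
noncomputable def neumannTerm (A : ℝ → 𝔸) : ℕ → ℝ → 𝔸
  | 0 => fun _ => 1
  | n + 1 => fun x => ∫ t in 0..x, A t * neumannTerm A n t

theorem continuous_neumannTerm {A : ℝ → 𝔸} (hA : AEStronglyMeasurable A volume)
    {K : ℝ} (hK : ∀ x, ‖A x‖ ≤ K) (n : ℕ) : Continuous (neumannTerm A n) := by
  induction n with
  | zero => exact continuous_const
  | succ n ih =>
    exact intervalIntegral.continuous_primitive (fun a b =>
      (intervalIntegrable_of_norm_le_const hA hK a b).mul_continuousOn ih.continuousOn) 0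

theorem norm_neumannTerm_le [NormOneClass 𝔸] {A : ℝ → 𝔸} {K : ℝ} (hK : ∀ x, ‖A x‖ ≤ K) (n : ℕ)
    {x : ℝ} (hx : 0 ≤ x) : ‖neumannTerm A n x‖ ≤ (K * x) ^ n / n.factorial := by
  have hK0 : 0 ≤ K := (norm_nonneg _).trans (hK 0)
  induction n generalizing x with
  | zero => simp [neumannTerm]
  | succ n ih =>
    have h1 : ‖neumannTerm A (n + 1) x‖ ≤
        ∫ t in 0..x, K ^ (n + 1) / n.factorial * t ^ n := by
      refine intervalIntegral.norm_integral_le_of_norm_le hx (ae_of_all _ fun t ht => ?_)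
        (Continuous.intervalIntegrable (by fun_prop) _ _)
      refine (norm_mul_le _ _).trans
        ((mul_le_mul (hK t) (ih ht.1.le) (norm_nonneg _) hK0).trans_eq ?_)
      ring
    refine h1.trans_eq ?_
    rw [intervalIntegral.integral_const_mul, integral_pow, Nat.factorial_succ]
    push_cast
    field_simp
    ring

/-- The linear Volterra equation with bounded coefficient has a continuous solution. -/
theorem exists_continuousOn_eq_one_add_integral [CompleteSpace 𝔸] [NormOneClass 𝔸] {A : ℝ → 𝔸}
    (hA : AEStronglyMeasurable A volume) {K : ℝ} (hK : ∀ x, ‖A x‖ ≤ K) (L : ℝ) :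
    ∃ Y : ℝ → 𝔸, ContinuousOn Y (Icc 0 L) ∧
      ∀ x ∈ Icc 0 L, Y x = 1 + ∫ t in 0..x, A t * Y t := by
  have hK0 : 0 ≤ K := (norm_nonneg _).trans (hK 0)
  have hsum : Summable fun n : ℕ => (K * L) ^ n / n.factorial :=
    Real.summable_pow_div_factorial _
  have hbound : ∀ n : ℕ, ∀ x ∈ Icc 0 L,
      ‖neumannTerm A n x‖ ≤ (K * L) ^ n / n.factorial := fun n x hx =>
    (norm_neumannTerm_le hK n hx.1).trans (by
      have h1 := hx.1
      have h2 := hx.2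
      gcongr)
  have hsummable : ∀ x ∈ Icc 0 L, Summable fun n => neumannTerm A n x := fun x hx =>
    Summable.of_norm_bounded hsum fun n => hbound n x hx
  refine ⟨fun x => ∑' n, neumannTerm A n x,
    continuousOn_tsum (fun n => (continuous_neumannTerm hA hK n).continuousOn) hsum hbound,
    fun x hx => ?_⟩
  have hsub : ∀ t ∈ uIoc 0 x, t ∈ Icc 0 L := fun t ht => by
    rw [uIoc_of_le hx.1] at ht
    exact ⟨ht.1.le, ht.2.trans hx.2⟩
  have hint := intervalIntegral.hasSum_integral_of_dominated_convergence (a := 0) (b := x)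
    (μ := volume) (F := fun n t => A t * neumannTerm A n t)
    (f := fun t => A t * ∑' n, neumannTerm A n t)
    (fun n _ => K * ((K * L) ^ n / n.factorial))
    (fun n => (hA.mul (continuous_neumannTerm hA hK n).aestronglyMeasurable).restrict)
    (fun n => ae_of_all _ fun t ht => (norm_mul_le _ _).trans
      (mul_le_mul (hK t) (hbound n t (hsub t ht)) (norm_nonneg _) hK0))
    (ae_of_all _ fun t _ => hsum.mul_left K)
    intervalIntegrable_const
    (ae_of_all _ fun t ht => (hsummable t (hsub t ht)).hasSum.mul_left _)
  simp only
  -- The zeroth term is `1`, and the shifted series is by definition the series of termwise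
  -- integrals.
  rw [(hsummable x hx).tsum_eq_zero_add, ← hint.tsum_eq]
  rfl

/-- On an interval where the coefficient is constant and nilpotent of order two, the solution of
the Volterra equation is affine. -/
theorem eq_one_add_mul_of_eq_one_add_integral [CompleteSpace 𝔸] {A Y : ℝ → 𝔸} {B : 𝔸} {K L : ℝ}
    (hA : AEStronglyMeasurable A volume) (hK : ∀ x, ‖A x‖ ≤ K) (hY : ContinuousOn Y (Icc 0 L))
    (h : ∀ x ∈ Icc 0 L, Y x = 1 + ∫ t in 0..x, A t * Y t) (hB : B * B = 0) {s t : ℝ}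
    (hs : s ∈ Icc 0 L) (ht : t ∈ Icc 0 L) (hst : s ≤ t) (hAB : ∀ x ∈ Ioo s t, A x = B) :
    Y t = (1 + (t - s) • B) * Y s := by
  have h0 : (0 : ℝ) ∈ Icc 0 L := ⟨le_rfl, hs.1.trans hs.2⟩
  have hdiff : ∀ x ∈ Icc s t, Y x - Y s = ∫ y in s..x, B * Y y := by
    intro x hx
    have hxL : x ∈ Icc 0 L := ⟨hs.1.trans hx.1, hx.2.trans ht.2⟩
    rw [h x hxL, h s hs, add_sub_add_left_eq_sub, intervalIntegral.integral_interval_sub_left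
      (intervalIntegrable_mul_of_continuousOn hA hK hY h0 hxL)
      (intervalIntegrable_mul_of_continuousOn hA hK hY h0 hs)]
    refine intervalIntegral.integral_congr_uIoo fun y hy => ?_
    rw [uIoo_of_le hx.1] at hy
    simp only [hAB y ⟨hy.1, hy.2.trans_le hx.2⟩]
  -- `B` applied to the increment of `Y` is the integral of `B * B * Y = 0`, so `B * Y` is constant.
  have hBY : ∀ x ∈ Icc s t, B * Y x = B * Y s := by
    intro x hx
    have hxL : x ∈ Icc 0 L := ⟨hs.1.trans hx.1, hx.2.trans ht.2⟩
    have hi : IntervalIntegrable (fun y => B * Y y) volume s x :=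
      (continuousOn_const.mul (hY.mono (uIcc_subset_Icc hs hxL))).intervalIntegrable
    have := (ContinuousLinearMap.mul ℝ 𝔸 B).intervalIntegral_comp_comm hi
    simp only [ContinuousLinearMap.mul_apply', ← mul_assoc, hB, zero_mul,
      intervalIntegral.integral_zero] at this
    rw [← sub_eq_zero, ← mul_sub, hdiff x hx, ← this]
  have h1 := hdiff t ⟨hst, le_rfl⟩
  have h2 : ∫ y in s..t, B * Y y = ∫ _ in s..t, B * Y s :=
    intervalIntegral.integral_congr fun y hy => hBY y (by rwa [uIcc_of_le hst] at hy)
  rw [h2, intervalIntegral.integral_const, sub_eq_iff_eq_add] at h1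
  rw [h1, add_mul, one_mul, smul_mul_assoc, add_comm]

end Volterra

/-! ### Existence of the monodromy matrix for bounded Hamiltonians. -/

namespace CanonicalSystem

/-- Solutions of the integrated form of the canonical system with bounded Hamiltonian form its
monodromy matrix. -/
theorem isMonodromyMatrix_of_eq_one_add_integral {H : ℝ → Mat2} {L K : ℝ} (hL : 0 ≤ L)
    (hH : AEStronglyMeasurable H volume) (hK : ∀ x, ‖H x‖ ≤ K) {M : ℝ → ℂ → Mat2}
    (hc : ∀ z, ContinuousOn (fun x => M x z) (Icc 0 L))
    (h : ∀ z, ∀ x ∈ Icc 0 L, M x z = 1 + ∫ t in 0..x, (-(z • (J * H t))) * M t z) :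
    IsMonodromyMatrix H L M := by
  intro z
  have h0 : (0 : ℝ) ∈ Icc 0 L := ⟨le_rfl, hL⟩
  have hK0 : 0 ≤ K := (norm_nonneg _).trans (hK 0)
  have hA : AEStronglyMeasurable (fun t => -(z • (J * H t))) volume :=
    ((hH.const_mul J).const_smul z).neg
  have hAK : ∀ t, ‖-(z • (J * H t))‖ ≤ ‖z‖ * K := fun t => by
    rw [norm_neg, norm_smul]
    gcongr
    exact (_root_.norm_mul_le _ _).trans
      ((mul_le_of_le_one_left (norm_nonneg _) norm_J_le).trans (hK t))
  have hint : ∀ {s t}, s ∈ Icc 0 L → t ∈ Icc 0 L →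
      IntervalIntegrable (fun x => (-(z • (J * H x))) * M x z) volume s t :=
    fun hs ht => intervalIntegrable_mul_of_continuousOn hA hAK (hc z) hs ht
  obtain ⟨B, hB⟩ := isCompact_Icc.exists_bound_of_continuousOn (hc z)
  have hB0 : 0 ≤ B := (norm_nonneg _).trans (hB 0 h0)
  refine ⟨?_, ?_, ?_⟩
  · refine LipschitzOnWith.absolutelyContinuousOnInterval (K := Real.toNNReal (‖z‖ * K * B)) ?_
    rw [uIcc_of_le hL]
    refine LipschitzOnWith.of_dist_le_mul fun x hx y hy => ?_
    rw [Real.coe_toNNReal _ (by positivity), dist_eq_norm, Real.dist_eq, h z x hx, h z y hy,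
      add_sub_add_left_eq_sub, intervalIntegral.integral_interval_sub_left (hint h0 hx)
        (hint h0 hy)]
    refine intervalIntegral.norm_integral_le_of_norm_le_const fun t ht => ?_
    refine (_root_.norm_mul_le _ _).trans
      (mul_le_mul (hAK t) (hB t ?_) (norm_nonneg _) (by positivity))
    exact uIcc_subset_Icc hy hx (uIoc_subset_uIcc ht)
  · rw [h z 0 h0, intervalIntegral.integral_same, add_zero]
  · filter_upwards [(hint h0 ⟨hL, le_rfl⟩).ae_hasDerivAt_integral] with x hx hx0
    have hx1 : x ∈ Icc 0 L := Ioo_subset_Icc_self hx0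
    have hd := (hx (by rwa [uIcc_of_le hL]) 0 left_mem_uIcc).const_add (1 : Mat2)
    have hd' : HasDerivAt (fun t => M t z) ((-(z • (J * H x))) * M x z) x :=
      hd.congr_of_eventuallyEq (by
        filter_upwards [Icc_mem_nhds hx0.1 hx0.2] with t ht using h z t ht)
    refine ⟨hd'.differentiableAt, ?_⟩
    rw [hd'.deriv, neg_mul, smul_mul_assoc, mul_neg, mul_smul_comm, ← mul_assoc, ← mul_assoc,
      J_mul_J, neg_one_mul, neg_mul, smul_neg, neg_neg]

theorem exists_eq_one_add_integral {H : ℝ → Mat2} {K : ℝ}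
    (hH : AEStronglyMeasurable H volume) (hK : ∀ x, ‖H x‖ ≤ K) (L : ℝ) :
    ∃ M : ℝ → ℂ → Mat2, (∀ z, ContinuousOn (fun x => M x z) (Icc 0 L)) ∧
      ∀ z, ∀ x ∈ Icc 0 L, M x z = 1 + ∫ t in 0..x, (-(z • (J * H t))) * M t z := by
  have key : ∀ z : ℂ, ∃ Y : ℝ → Mat2, ContinuousOn Y (Icc 0 L) ∧
      ∀ x ∈ Icc 0 L, Y x = 1 + ∫ t in 0..x, (-(z • (J * H t))) * Y t := fun z =>
    exists_continuousOn_eq_one_add_integral (K := ‖z‖ * K)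
      ((hH.const_mul J).const_smul z).neg (fun t => by
        change ‖-(z • (J * H t))‖ ≤ _
        rw [norm_neg, norm_smul]
        gcongr
        exact (_root_.norm_mul_le _ _).trans
          ((mul_le_of_le_one_left (norm_nonneg _) norm_J_le).trans (hK t))) L
  choose Y hY1 hY2 using key
  exact ⟨fun x z => Y z x, hY1, hY2⟩

/-! ### The switching Hamiltonian. -/

theorem switchPoint_one (p : ℝ) : switchPoint p 1 = 0 := by simp [switchPoint]

theorem one_sub_switchPoint (p : ℝ) (j : ℕ) :
    1 - switchPoint p j = (j : ℝ) ^ (-(1 / p - 1)) := by simp [switchPoint]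

theorem one_div_sub_one_pos {p : ℝ} (hp0 : 0 < p) (hp1 : p < 1) : 0 < 1 / p - 1 := by
  rw [sub_pos, lt_div_iff₀ hp0]; linarith

theorem strictMono_switchPoint {p : ℝ} (hp0 : 0 < p) (hp1 : p < 1) :
    StrictMono fun j : ℕ => switchPoint p (j + 1) := by
  have hα := one_div_sub_one_pos hp0 hp1
  refine strictMono_nat_of_lt_succ fun j => ?_
  refine sub_lt_sub_left (Real.rpow_lt_rpow_of_neg (by positivity) ?_ (by linarith)) 1
  push_cast
  linarith

theorem switchPoint_lt_one (p : ℝ) (j : ℕ) : switchPoint p (j + 1) < 1 := by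
  have : (0 : ℝ) < ((j + 1 : ℕ) : ℝ) ^ (-(1 / p - 1)) := by positivity
  rw [switchPoint]
  linarith

theorem switchPoint_nonneg {p : ℝ} (hp0 : 0 < p) (hp1 : p < 1) (j : ℕ) :
    0 ≤ switchPoint p (j + 1) := by
  rw [← switchPoint_one p]
  exact (strictMono_switchPoint hp0 hp1).monotone (Nat.zero_le j)

theorem tendsto_switchPoint {p : ℝ} (hp0 : 0 < p) (hp1 : p < 1) :
    Tendsto (fun j : ℕ => switchPoint p (j + 1)) atTop (𝓝 1) := by
  have h := ((tendsto_rpow_neg_atTop (one_div_sub_one_pos hp0 hp1)).comp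
    (tendsto_natCast_atTop_atTop (R := ℝ))).const_sub 1
  rw [sub_zero] at h
  exact h.comp (tendsto_add_atTop_nat 1)

/-- The direction of the Hamiltonian between consecutive switching points. -/
noncomputable def switchVector (j : ℕ) : EuclideanSpace ℝ (Fin 2) :=
  if Even j then EuclideanSpace.single 0 1 else EuclideanSpace.single 1 1

theorem norm_switchVector (j : ℕ) : ‖switchVector j‖ = 1 := by
  unfold switchVector
  split_ifs <;> simp

theorem proj_single_zero : proj (EuclideanSpace.single 0 1) = !![1, 0; 0, 0] := by
  ext i k
  fin_cases i <;> fin_cases k <;> simp [proj]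

theorem proj_single_one : proj (EuclideanSpace.single 1 1) = !![0, 0; 0, 1] := by
  ext i k
  fin_cases i <;> fin_cases k <;> simp [proj]

/-- Indices are shifted by one, so even `j` corresponds to `diag (1, 0)`. For odd `j`, strict
monotonicity keeps the open interval away from all the closed intervals in the definition. -/
theorem switchHamiltonian_eq_proj {p : ℝ} (hp0 : 0 < p) (hp1 : p < 1) {j : ℕ} {x : ℝ}
    (hx : x ∈ Ioo (switchPoint p (j + 1)) (switchPoint p (j + 2))) :
    switchHamiltonian p x = proj (switchVector j) := by
  have hmono := strictMono_switchPoint hp0 hp1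
  unfold switchHamiltonian switchVector
  rcases Nat.even_or_odd' j with ⟨m, rfl | rfl⟩
  · rw [if_pos ⟨m, Ioo_subset_Icc_self hx⟩, if_pos (even_two_mul m), proj_single_zero]
  · rw [if_neg, if_neg (by simp), proj_single_one]
    rintro ⟨i, hi⟩
    have h1 : 2 * i < 2 * m + 2 := hmono.lt_iff_lt.1 (hi.1.trans_lt hx.2)
    have h2 : 2 * m + 1 < 2 * i + 1 := hmono.lt_iff_lt.1 (hx.1.trans_le hi.2)
    omega

theorem switchHamiltonian_mem (p x : ℝ) : ∃ e : EuclideanSpace ℝ (Fin 2), ‖e‖ = 1 ∧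
    switchHamiltonian p x = proj e := by
  unfold switchHamiltonian
  split_ifs
  · exact ⟨EuclideanSpace.single 0 1, by simp, proj_single_zero.symm⟩
  · exact ⟨EuclideanSpace.single 1 1, by simp, proj_single_one.symm⟩

theorem norm_proj_le {e : EuclideanSpace ℝ (Fin 2)} (he : ‖e‖ = 1) : ‖proj e‖ ≤ 1 :=
  norm_projection_le (star_proj e) (proj_mul_proj he)

theorem norm_switchHamiltonian_le (p x : ℝ) : ‖switchHamiltonian p x‖ ≤ 1 := by
  obtain ⟨e, he, h⟩ := switchHamiltonian_mem p x
  rw [h]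
  exact norm_proj_le he

theorem aestronglyMeasurable_switchHamiltonian (p : ℝ) :
    AEStronglyMeasurable (switchHamiltonian p) volume := by
  have hs : MeasurableSet {x : ℝ | ∃ j : ℕ,
      x ∈ Icc (switchPoint p (2 * j + 1)) (switchPoint p (2 * j + 2))} := by
    have : {x : ℝ | ∃ j : ℕ, x ∈ Icc (switchPoint p (2 * j + 1)) (switchPoint p (2 * j + 2))} =
        ⋃ j : ℕ, Icc (switchPoint p (2 * j + 1)) (switchPoint p (2 * j + 2)) := by
      ext x
      simp
    rw [this]
    exact MeasurableSet.iUnion fun _ => measurableSet_Icc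
  exact (StronglyMeasurable.ite hs stronglyMeasurable_const
    stronglyMeasurable_const).aestronglyMeasurable

theorem isCanonicalSystem_switchHamiltonian (p : ℝ) :
    IsCanonicalSystem (switchHamiltonian p) 1 where
  pos := one_pos
  integrable := by
    rw [← intervalIntegrable_iff_integrableOn_Icc_of_le zero_le_one]
    exact intervalIntegrable_of_norm_le_const (aestronglyMeasurable_switchHamiltonian p)
      (norm_switchHamiltonian_le p) 0 1
  nonneg := ae_of_all _ fun x _ => by
    obtain ⟨e, he, h⟩ := switchHamiltonian_mem p x
    have := Matrix.posSemidef_conjTranspose_mul_self (proj e)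
    rwa [← Matrix.star_eq_conjTranspose, star_proj, proj_mul_proj he, ← h] at this

theorem isTraceNormed_switchHamiltonian (p : ℝ) : IsTraceNormed (switchHamiltonian p) 1 :=
  ae_of_all _ fun x _ => by
    unfold switchHamiltonian
    split_ifs <;> simp [Matrix.trace_fin_two]

/-! ### The switching Hamiltonian satisfies the approximation condition. -/

theorem Approximable.mono {H : ℝ → Mat2} {L d d' : ℝ} (h : Approximable H L d) (hd : d ≤ d') :
    Approximable H L d' := by
  obtain ⟨C, hC, hev⟩ := h
  refine ⟨C, hC, ?_⟩
  filter_upwards [hev, eventually_ge_atTop 1] with R hR hR1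
  obtain ⟨G, N, x, e, a, hG, ha, h1, h2, h3, h4⟩ := hR
  have hpow : C * R ^ d ≤ C * R ^ d' := by gcongr
  have hpow' : C * R ^ (d - 1) ≤ C * R ^ (d' - 1) := by gcongr
  exact ⟨G, N, x, e, a, hG, ha, h1.trans hpow', h2.trans hpow', h3.trans hpow, h4.trans hpow⟩

theorem approximable_switchHamiltonian_of_lt_one {p d : ℝ} (hp0 : 0 < p) (hp1 : p < 1)
    (hpd : p < d) (hd1 : d < 1) : Approximable (switchHamiltonian p) 1 d := by
  have hα := one_div_sub_one_pos hp0 hp1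
  have hmono := strictMono_switchPoint hp0 hp1
  have hd0 : 0 < d := hp0.trans hpd
  set α := 1 / p - 1 with hαdef
  -- Positivity of `ε` encodes `p < d`. Since `(1 - d) / α + (1 - d) ε = d`, it is the room left for
  -- absorbing the logarithm by `log t ≤ t ^ ε / ε`.
  set ε := d / (1 - d) - 1 / α with hε
  have hε0 : 0 < ε := by
    have h1 : 1 / α = p / (1 - p) := by rw [hαdef]; field_simp
    rw [hε, h1, sub_pos, div_lt_div_iff₀ (by linarith) (by linarith)]
    linarith
  -- The summands serve (i) and (ii), then (iii), then (iv) through `log R ≤ R ^ d / d`.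
  refine ⟨2 + 3 ^ ε / ε + 1 / d, by positivity, ?_⟩
  filter_upwards [eventually_ge_atTop 1] with R hR
  have hR0 : 0 < R := by linarith
  -- Chosen so that `X ^ (-α) = R ^ (d - 1)`: cutting after about `X` switches leaves a tail of
  -- admissible length, on which the weight can be `1`.
  set X := R ^ ((1 - d) / α) with hX
  have hX1 : 1 ≤ X := Real.one_le_rpow hR (div_nonneg (by linarith) hα.le)
  obtain ⟨m, hm⟩ : ∃ m : ℕ, ⌊X⌋₊ = m + 1 :=
    Nat.exists_eq_add_of_le' ((Nat.one_le_floor_iff X).2 hX1)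
  have hmX : ((m + 1 : ℕ) : ℝ) ≤ X := hm ▸ Nat.floor_le (by linarith)
  have hXm : X < ((m + 2 : ℕ) : ℝ) := by
    have := Nat.lt_floor_add_one X
    rw [hm] at this
    push_cast at this ⊢
    linarith
  have htail : 1 - switchPoint p (m + 2) ≤ R ^ (d - 1) := by
    rw [one_sub_switchPoint]
    have h1 : R ^ (d - 1) = X ^ (-α) := by
      rw [hX, ← Real.rpow_mul hR0.le]
      congr 1
      field_simp
      ring
    rw [h1]
    exact Real.rpow_le_rpow_of_nonpos (by linarith) hXm.le (by linarith)
  -- The approximation is exact before the tail, so (i) does not limit the weight there; `w ^ 2 = R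
  -- ^ (d - 1)` is what (ii) requires.
  set w := R ^ ((d - 1) / 2) with hw
  have hw0 : 0 < w := by positivity
  have hw1 : w ≤ 1 := Real.rpow_le_one_of_one_le_of_nonpos hR (by linarith)
  have hww : w ^ 2 = R ^ (d - 1) := by
    rw [hw, ← Real.rpow_natCast, ← Real.rpow_mul hR0.le]
    congr 1
    push_cast
    ring
  have hlogw : Real.log w = (d - 1) / 2 * Real.log R := Real.log_rpow hR0 _
  have hlogR : 0 ≤ Real.log R := Real.log_nonneg hR
  set x : ℕ → ℝ := fun j => if j ≤ m + 1 then switchPoint p (j + 1) else 1 with hx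
  set a : ℕ → ℝ := fun j => if j < m + 1 then w else 1 with ha
  set G : ℝ → Mat2 := fun t => if t < switchPoint p (m + 2) then switchHamiltonian p t
    else proj (switchVector (m + 1)) with hG
  have hx1 : ∀ j < m + 1, x j = switchPoint p (j + 1) ∧ x (j + 1) = switchPoint p (j + 2) := by
    intro j hj
    simp only [hx]
    rw [if_pos hj.le, if_pos (by omega)]
    exact ⟨rfl, rfl⟩
  have hxl : x (m + 1) = switchPoint p (m + 2) := by simp [hx]
  have hxr : x (m + 2) = 1 := by simp [hx]
  have ha1 : ∀ j < m + 1, a j = w := fun j hj => if_pos hj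
  have ha2 : a (m + 1) = 1 := if_neg (lt_irrefl _)
  have hRd : 1 ≤ R ^ d := Real.one_le_rpow hR hd0.le
  have hRd' : 0 < R ^ (d - 1) := by positivity
  have hε' : 0 < 3 ^ ε / ε := by positivity
  have hd' : 0 < 1 / d := by positivity
  refine ⟨G, m + 2, x, switchVector, a, ⟨?_, hxr, ?_, fun j _ => norm_switchVector j, ?_⟩,
    ?_, ?_, ?_, ?_, ?_⟩
  · rw [(hx1 0 (by omega)).1, zero_add, switchPoint_one]
  · intro j hj
    rcases (Nat.lt_succ_iff.1 hj).lt_or_eq with h | rfl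
    · rw [(hx1 j h).1, (hx1 j h).2]
      exact hmono (Nat.lt_succ_self j)
    · rw [hxl, hxr]
      exact switchPoint_lt_one p (m + 1)
  · intro j hj t ht
    rcases (Nat.lt_succ_iff.1 hj).lt_or_eq with h | rfl
    · rw [(hx1 j h).1, (hx1 j h).2] at ht
      have hle : switchPoint p (j + 2) ≤ switchPoint p (m + 2) :=
        hmono.monotone (show j + 1 ≤ m + 1 by omega)
      simp only [hG]
      rw [if_pos (ht.2.trans_le hle), switchHamiltonian_eq_proj hp0 hp1 ht]
    · rw [hxl] at ht
      exact if_neg (not_lt.2 ht.1.le)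
  · intro j _
    simp only [ha]
    split_ifs
    · exact ⟨hw0, hw1⟩
    · exact ⟨one_pos, le_rfl⟩
  · have hz : ∀ j ∈ Finset.range (m + 1),
        1 / a j ^ 2 * ∫ t in x j..x (j + 1), ‖switchHamiltonian p t - G t‖ = 0 := by
      intro j hj
      have hj' := Finset.mem_range.1 hj
      rw [(hx1 j hj').1, (hx1 j hj').2]
      have : ∫ t in switchPoint p (j + 1)..switchPoint p (j + 2),
          ‖switchHamiltonian p t - G t‖ =
          ∫ _ in switchPoint p (j + 1)..switchPoint p (j + 2), (0 : ℝ) := by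
        refine intervalIntegral.integral_congr_uIoo fun t ht => ?_
        rw [uIoo_of_le (hmono (Nat.lt_succ_self j)).le] at ht
        have hle : switchPoint p (j + 2) ≤ switchPoint p (m + 2) :=
          hmono.monotone (show j + 1 ≤ m + 1 by omega)
        simp only [hG]
        rw [if_pos (ht.2.trans_le hle), sub_self, norm_zero]
      rw [this, intervalIntegral.integral_zero, mul_zero]
    rw [Finset.sum_range_succ, Finset.sum_eq_zero hz, zero_add, ha2, hxl, hxr, one_pow, div_one,
      one_mul]
    have hlt := switchPoint_lt_one p (m + 1)
    have hb : ‖∫ t in switchPoint p (m + 2)..1, ‖switchHamiltonian p t - G t‖‖ ≤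
        2 * |1 - switchPoint p (m + 2)| := by
      refine intervalIntegral.norm_integral_le_of_norm_le_const fun t _ => ?_
      rw [norm_norm]
      have h1 := norm_switchHamiltonian_le p t
      have h2 : ‖G t‖ ≤ 1 := by
        simp only [hG]
        split_ifs
        · exact h1
        · exact norm_proj_le (norm_switchVector _)
      linarith [norm_sub_le (switchHamiltonian p t) (G t)]
    rw [abs_of_pos (by linarith)] at hb
    have := (le_abs_self _).trans hb
    nlinarith
  · have hz : ∀ j ∈ Finset.range (m + 1), a j ^ 2 * (x (j + 1) - x j) =
        R ^ (d - 1) * (switchPoint p (j + 1 + 1) - switchPoint p (j + 1)) := by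
      intro j hj
      have hj' := Finset.mem_range.1 hj
      rw [(hx1 j hj').1, (hx1 j hj').2, ha1 j hj', hww]
    rw [Finset.sum_range_succ, Finset.sum_congr rfl hz, ← Finset.mul_sum,
      Finset.sum_range_sub (fun j => switchPoint p (j + 1)), ha2, hxl, hxr, one_pow, one_mul,
      zero_add, switchPoint_one, sub_zero]
    have hlt := switchPoint_lt_one p (m + 1)
    nlinarith
  · rw [show m + 2 - 1 = m + 1 from rfl]
    have hterm : ∀ j ∈ Finset.range (m + 1),
        Real.log (1 + ‖proj (switchVector j) - proj (switchVector (j + 1))‖ /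
          (a j * a (j + 1))) ≤ 3 ^ ε / ε * R ^ ((1 - d) * ε) := by
      intro j hj
      have hj' := Finset.mem_range.1 hj
      have haa : R ^ (d - 1) ≤ a j * a (j + 1) := by
        rw [ha1 j hj', ← hww, sq]
        gcongr
        simp only [ha]
        split_ifs
        · exact le_rfl
        · exact hw1
      have hPQ : ‖proj (switchVector j) - proj (switchVector (j + 1))‖ ≤ 2 := by
        have h1 := norm_proj_le (norm_switchVector j)
        have h2 := norm_proj_le (norm_switchVector (j + 1))
        linarith [norm_sub_le (proj (switchVector j)) (proj (switchVector (j + 1)))]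
      have hR1d : 1 ≤ R ^ (1 - d) := Real.one_le_rpow hR (by linarith)
      have hle : 1 + ‖proj (switchVector j) - proj (switchVector (j + 1))‖ /
          (a j * a (j + 1)) ≤ 3 * R ^ (1 - d) := by
        have h1 : ‖proj (switchVector j) - proj (switchVector (j + 1))‖ / (a j * a (j + 1)) ≤
            2 / R ^ (d - 1) := by gcongr
        have h2 : 2 / R ^ (d - 1) = 2 * R ^ (1 - d) := by
          rw [div_eq_mul_inv, ← Real.rpow_neg hR0.le, neg_sub]
        linarith
      have hnn : 0 ≤ ‖proj (switchVector j) - proj (switchVector (j + 1))‖ /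
          (a j * a (j + 1)) := div_nonneg (norm_nonneg _) (hRd'.le.trans haa)
      refine (Real.log_le_log (by linarith) hle).trans ?_
      refine (Real.log_le_rpow_div (by positivity) hε0).trans_eq ?_
      rw [Real.mul_rpow (by norm_num) (by positivity), ← Real.rpow_mul hR0.le]
      ring
    refine (Finset.sum_le_sum hterm).trans ?_
    rw [Finset.sum_const, Finset.card_range, nsmul_eq_mul]
    have hXR : X * R ^ ((1 - d) * ε) = R ^ d := by
      rw [hX, ← Real.rpow_add hR0]
      congr 1
      rw [hε]
      have : 1 - d ≠ 0 := by linarith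
      field_simp
      ring
    calc ((m + 1 : ℕ) : ℝ) * (3 ^ ε / ε * R ^ ((1 - d) * ε))
        ≤ X * (3 ^ ε / ε * R ^ ((1 - d) * ε)) := by gcongr
      _ = 3 ^ ε / ε * R ^ d := by rw [← hXR]; ring
      _ ≤ (2 + 3 ^ ε / ε + 1 / d) * R ^ d := by
        gcongr
        linarith
  · rw [show m + 2 - 1 = m + 1 from rfl, ha1 0 (by omega), ha2]
    have hz : ∀ j ∈ Finset.range m, |Real.log (a (j + 1) / a j)| = 0 := by
      intro j hj
      have hj' := Finset.mem_range.1 hj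
      rw [ha1 j (by omega), ha1 (j + 1) (by omega), div_self hw0.ne', Real.log_one, abs_zero]
    rw [Finset.sum_range_succ, Finset.sum_eq_zero hz, ha2, ha1 m (by omega), one_div,
      Real.log_inv, hlogw, inv_one, Real.log_one, abs_of_nonneg (by nlinarith)]
    have h1 := Real.log_le_rpow_div hR0.le hd0
    have h2 : Real.log R ≤ 1 / d * R ^ d := by rw [one_div_mul_eq_div]; exact h1
    have h3 : 0 ≤ (2 + 3 ^ ε / ε) * R ^ d := by positivity
    nlinarith

theorem approximable_switchHamiltonian {p d : ℝ} (hp0 : 0 < p) (hp1 : p < 1) (hpd : p < d) :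
    Approximable (switchHamiltonian p) 1 d := by
  -- The construction needs an exponent below `1`; larger `d` follow by monotonicity.
  obtain ⟨c, hc1, hc2⟩ := exists_between (lt_min hpd hp1)
  exact (approximable_switchHamiltonian_of_lt_one hp0 hp1 hc1
    (hc2.trans_le (min_le_right _ _))).mono (hc2.le.trans (min_le_left _ _))

/-! ### Lower bound for the order on the imaginary axis. -/

/-- Products of the real transfer matrices, alternately lower and upper triangular. -/
def transferProduct (s : ℕ → ℝ) : ℕ → Matrix (Fin 2) (Fin 2) ℝ
  | 0 => 1
  | j + 1 => (1 + s j • if Even j then !![0, 0; 1, 0] else !![0, 1; 0, 0]) * transferProduct s j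

theorem transferProduct_succ_zero (s : ℕ → ℝ) (j : ℕ) (k : Fin 2) :
    transferProduct s (j + 1) 0 k = transferProduct s j 0 k +
      if Even j then 0 else s j * transferProduct s j 1 k := by
  rw [transferProduct]
  split_ifs <;> simp [add_mul, Matrix.mul_apply, Fin.sum_univ_two]

theorem transferProduct_succ_one (s : ℕ → ℝ) (j : ℕ) (k : Fin 2) :
    transferProduct s (j + 1) 1 k = transferProduct s j 1 k +
      if Even j then s j * transferProduct s j 0 k else 0 := by
  rw [transferProduct]
  split_ifs <;> simp [add_mul, Matrix.mul_apply, Fin.sum_univ_two, add_comm]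

theorem transferProduct_nonneg {s : ℕ → ℝ} (hs : ∀ j, 0 ≤ s j) (j : ℕ) (i k : Fin 2) :
    0 ≤ transferProduct s j i k := by
  induction j generalizing i with
  | zero => fin_cases i <;> fin_cases k <;> simp [transferProduct]
  | succ j ih =>
    have h0 := ih 0
    have h1 := ih 1
    have h2 := hs j
    fin_cases i
    · simp only [Fin.zero_eta, transferProduct_succ_zero]
      split_ifs <;> positivity
    · simp only [Fin.mk_one, transferProduct_succ_one]
      split_ifs <;> positivity

theorem monotone_transferProduct {s : ℕ → ℝ} (hs : ∀ j, 0 ≤ s j) (i k : Fin 2) :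
    Monotone fun j => transferProduct s j i k := by
  refine monotone_nat_of_le_succ fun j => ?_
  have h0 := transferProduct_nonneg hs j 0 k
  have h1 := transferProduct_nonneg hs j 1 k
  have h2 := hs j
  fin_cases i
  · simp only [Fin.zero_eta, transferProduct_succ_zero]
    split_ifs
    · simp
    · nlinarith
  · simp only [Fin.mk_one, transferProduct_succ_one]
    split_ifs
    · nlinarith
    · simp

/-- When `s j ≥ 1`, a lower followed by an upper triangular factor dominates `!![2, 1; 1, 1]`
entrywise. The first pair makes all entries at least `1`, and each further pair doubles the lower
bound. -/
theorem two_pow_le_transferProduct {s : ℕ → ℝ} (m : ℕ)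
    (h1 : ∀ j < 2 * m + 2, 1 ≤ s j) (i k : Fin 2) :
    2 ^ m ≤ transferProduct s (2 * m + 2) i k := by
  induction m generalizing i with
  | zero =>
    have hs0 := h1 0 (by norm_num)
    have hs1 := h1 1 (by norm_num)
    have e0 : transferProduct s (2 * 0 + 2) 0 k =
        (1 : Matrix (Fin 2) (Fin 2) ℝ) 0 k + s 1 * ((1 : Matrix (Fin 2) (Fin 2) ℝ) 1 k +
          s 0 * (1 : Matrix (Fin 2) (Fin 2) ℝ) 0 k) := by
      rw [mul_zero, zero_add, transferProduct_succ_zero, transferProduct_succ_zero,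
        transferProduct_succ_one]
      simp [transferProduct]
    have e1 : transferProduct s (2 * 0 + 2) 1 k =
        (1 : Matrix (Fin 2) (Fin 2) ℝ) 1 k + s 0 * (1 : Matrix (Fin 2) (Fin 2) ℝ) 0 k := by
      rw [mul_zero, zero_add, transferProduct_succ_one, transferProduct_succ_one]
      simp [transferProduct]
    fin_cases i
    · simp only [Fin.zero_eta, e0]
      fin_cases k <;> simp [Matrix.one_apply] <;> nlinarith
    · simp only [Fin.mk_one, e1]
      fin_cases k <;> simp [Matrix.one_apply]; nlinarith
  | succ m ih =>
    have ih := ih fun j hj => h1 j (by omega)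
    have h0 := ih 0
    have h1' := ih 1
    have hp : (0 : ℝ) < 2 ^ m := by positivity
    have hs0 := h1 (2 * m + 2) (by omega)
    have hs1 := h1 (2 * m + 2 + 1) (by omega)
    have he : Even (2 * m + 2) := ⟨m + 1, by ring⟩
    have ho : ¬ Even (2 * m + 2 + 1) := by simp [parity_simps]
    have e0 : transferProduct s (2 * (m + 1) + 2) 0 k = transferProduct s (2 * m + 2) 0 k +
        s (2 * m + 2 + 1) * (transferProduct s (2 * m + 2) 1 k +
          s (2 * m + 2) * transferProduct s (2 * m + 2) 0 k) := by
      rw [show 2 * (m + 1) + 2 = 2 * m + 2 + 1 + 1 by ring, transferProduct_succ_zero, if_neg ho,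
        transferProduct_succ_zero, if_pos he, transferProduct_succ_one, if_pos he, add_zero]
    have e1 : transferProduct s (2 * (m + 1) + 2) 1 k = transferProduct s (2 * m + 2) 1 k +
        s (2 * m + 2) * transferProduct s (2 * m + 2) 0 k := by
      rw [show 2 * (m + 1) + 2 = 2 * m + 2 + 1 + 1 by ring, transferProduct_succ_one, if_neg ho,
        transferProduct_succ_one, if_pos he, add_zero]
    have h3 : 2 * 2 ^ m ≤ transferProduct s (2 * m + 2) 1 k +
        s (2 * m + 2) * transferProduct s (2 * m + 2) 0 k := by nlinarith
    rw [pow_succ']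
    fin_cases i
    · simp only [Fin.zero_eta, e0]
      nlinarith
    · simp only [Fin.mk_one, e1]
      exact h3

/-- At `z = i y` the solution at the switching points is, up to a diagonal conjugation, a product
of nonnegative matrices. -/
theorem norm_entry_eq_transferProduct {p : ℝ} (hp0 : 0 < p) (hp1 : p < 1) {M : ℝ → ℂ → Mat2}
    (hc : ∀ z, ContinuousOn (fun x => M x z) (Icc 0 1))
    (h : ∀ z, ∀ x ∈ Icc (0 : ℝ) 1,
      M x z = 1 + ∫ t in 0..x, (-(z • (J * switchHamiltonian p t))) * M t z)
    {y : ℝ} (hy : 0 ≤ y) (j : ℕ) (i k : Fin 2) :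
    ‖M (switchPoint p (j + 1)) (Complex.I * y) i k‖ =
      transferProduct (fun j => y * (switchPoint p (j + 2) - switchPoint p (j + 1))) j i k := by
  set s : ℕ → ℝ := fun j => y * (switchPoint p (j + 2) - switchPoint p (j + 1)) with hs
  have hmono := strictMono_switchPoint hp0 hp1
  have hs0 : ∀ j, 0 ≤ s j := fun j =>
    mul_nonneg hy (sub_nonneg.2 (hmono (Nat.lt_succ_self j)).le)
  set z : ℂ := Complex.I * y with hz
  have hmem : ∀ j, switchPoint p (j + 1) ∈ Icc (0 : ℝ) 1 := fun j =>
    ⟨switchPoint_nonneg hp0 hp1 j, (switchPoint_lt_one p j).le⟩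
  have hA : AEStronglyMeasurable (fun t => -(z • (J * switchHamiltonian p t))) volume :=
    (((aestronglyMeasurable_switchHamiltonian p).const_mul J).const_smul z).neg
  have hAK : ∀ t, ‖-(z • (J * switchHamiltonian p t))‖ ≤ ‖z‖ * 1 := fun t => by
    rw [norm_neg, norm_smul]
    gcongr
    exact (_root_.norm_mul_le _ _).trans
      ((mul_le_of_le_one_left (norm_nonneg _) norm_J_le).trans (norm_switchHamiltonian_le p t))
  have hstep : ∀ j, M (switchPoint p (j + 2)) z =
      (1 + (switchPoint p (j + 2) - switchPoint p (j + 1)) •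
        (-(z • (J * proj (switchVector j))))) * M (switchPoint p (j + 1)) z := by
    intro j
    refine eq_one_add_mul_of_eq_one_add_integral hA hAK (hc z) (h z) ?_ (hmem j) (hmem (j + 1))
      (hmono (Nat.lt_succ_self j)).le (fun x hx => by
        rw [switchHamiltonian_eq_proj hp0 hp1 hx])
    have hJ : J * proj (switchVector j) * (J * proj (switchVector j)) = 0 := by
      rw [mul_assoc, ← mul_assoc (proj _), proj_mul_J_mul_proj, mul_zero]
    rw [neg_mul_neg, smul_mul_smul_comm, hJ, smul_zero]
  -- At `z = i y` the off-diagonal entries of the factors are `-i` (lower) and `i` (upper) times a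
  -- nonnegative number. Conjugation by `diag (1, -i)` removes these phases without changing moduli
  -- of entries.
  set δ : Fin 2 → ℂ := ![1, -Complex.I] with hδ
  have hδn : ∀ i, ‖δ i‖ = 1 := by
    intro i
    fin_cases i <;> simp [hδ]
  have key : ∀ j i k, δ k * M (switchPoint p (j + 1)) z i k =
      δ i * ((transferProduct s j i k : ℝ) : ℂ) := by
    intro j
    induction j with
    | zero =>
      intro i k
      rw [zero_add, switchPoint_one, h z 0 ⟨le_rfl, zero_le_one⟩, intervalIntegral.integral_same,
        add_zero]
      fin_cases i <;> fin_cases k <;> simp [transferProduct]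
    | succ j ih =>
      intro i k
      have i0 := ih 0 k
      have i1 := ih 1 k
      have hII := Complex.I_mul_I
      rw [show j + 1 + 1 = j + 2 from rfl, hstep j]
      rcases Nat.even_or_odd j with he | ho
      · have hv : proj (switchVector j) = !![1, 0; 0, 0] := by
          rw [switchVector, if_pos he, proj_single_zero]
        rw [hv]
        fin_cases i
        · simp only [Fin.zero_eta, transferProduct_succ_zero, if_pos he]
          simpa [J, add_mul, Matrix.mul_apply, Fin.sum_univ_two] using i0
        · simp only [Fin.mk_one, transferProduct_succ_one, if_pos he]
          simp [J, hδ, add_mul, Matrix.mul_apply, Fin.sum_univ_two, hs, hz] at i0 i1 ⊢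
          linear_combination i1 - (switchPoint p (j + 2) - switchPoint p (j + 1)) *
            (Complex.I * y) * i0
      · have hne : ¬ Even j := Nat.not_even_iff_odd.2 ho
        have hv : proj (switchVector j) = !![0, 0; 0, 1] := by
          rw [switchVector, if_neg hne, proj_single_one]
        rw [hv]
        fin_cases i
        · simp only [Fin.zero_eta, transferProduct_succ_zero, if_neg hne]
          simp [J, hδ, add_mul, Matrix.mul_apply, Fin.sum_univ_two, hs, hz] at i0 i1 ⊢
          linear_combination i0 + (switchPoint p (j + 2) - switchPoint p (j + 1)) *
            (Complex.I * y) * i1 - (switchPoint p (j + 2) - switchPoint p (j + 1)) *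
            y * (transferProduct s j 1 k : ℂ) * hII
        · simp only [Fin.mk_one, transferProduct_succ_one, if_neg hne]
          simpa [J, add_mul, Matrix.mul_apply, Fin.sum_univ_two] using i1
  have := congrArg norm (key j i k)
  rwa [norm_mul, norm_mul, hδn, hδn, one_mul, one_mul, Complex.norm_real, Real.norm_eq_abs,
    abs_of_nonneg (transferProduct_nonneg hs0 j i k)] at this

/-- With `1 / p = 1 + α` this is the mean value bound for `t ^ (-α)`, obtained from `log (v / u) ≥ 1
/ v` and `exp t ≥ 1 + t`. -/
theorem le_switchPoint_sub {p : ℝ} (hp0 : 0 < p) (hp1 : p < 1) (j : ℕ) :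
    (1 / p - 1) / ((j + 2 : ℕ) : ℝ) ^ (1 / p) ≤ switchPoint p (j + 2) - switchPoint p (j + 1) := by
  have hα := one_div_sub_one_pos hp0 hp1
  set α := 1 / p - 1 with hαdef
  set u : ℝ := ((j + 1 : ℕ) : ℝ) with hu
  set v : ℝ := ((j + 2 : ℕ) : ℝ) with hv
  have hu0 : 0 < u := by positivity
  have hv0 : 0 < v := by positivity
  have huv : v = u + 1 := by rw [hu, hv]; push_cast; ring
  have h1 : 1 + α / v ≤ u ^ (-α) / v ^ (-α) := by
    have e1 : u ^ (-α) / v ^ (-α) = Real.exp (α * Real.log (v / u)) := by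
      rw [← Real.div_rpow hu0.le hv0.le, Real.rpow_def_of_pos (by positivity),
        ← inv_div v u, Real.log_inv]
      congr 1
      ring
    have e2 : 1 / v ≤ Real.log (v / u) := by
      have := Real.one_sub_inv_le_log_of_pos (show 0 < v / u by positivity)
      rw [inv_div] at this
      refine le_trans (le_of_eq ?_) this
      rw [eq_sub_iff_add_eq, ← add_div, huv, add_comm, div_self (by positivity)]
    rw [e1]
    have e3 : α / v ≤ α * Real.log (v / u) := by
      rw [div_eq_mul_one_div]
      gcongr
    linarith [Real.add_one_le_exp (α * Real.log (v / u))]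
  have hvα : 0 < v ^ (-α) := by positivity
  have h2 : switchPoint p (j + 2) - switchPoint p (j + 1) = u ^ (-α) - v ^ (-α) := by
    rw [switchPoint, switchPoint]
    ring
  have h3 : α / v ^ (1 / p) = α / v * v ^ (-α) := by
    rw [show 1 / p = 1 + α by rw [hαdef]; ring, Real.rpow_add hv0, Real.rpow_one,
      Real.rpow_neg hv0.le]
    field_simp
  rw [le_div_iff₀ hvα] at h1
  rw [h2, h3]
  linarith

/-- The size of `y` makes the first `2 m + 2` parameters at least `1`; later factors do not decrease
any entry, and continuity of the solution carries the bound to the limit point `1` of the switching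
points. -/
theorem two_pow_le_norm_entry {p : ℝ} (hp0 : 0 < p) (hp1 : p < 1) {M : ℝ → ℂ → Mat2}
    (hc : ∀ z, ContinuousOn (fun x => M x z) (Icc 0 1))
    (h : ∀ z, ∀ x ∈ Icc (0 : ℝ) 1,
      M x z = 1 + ∫ t in 0..x, (-(z • (J * switchHamiltonian p t))) * M t z)
    {y : ℝ} (m : ℕ) (hy : ((2 * m + 3 : ℕ) : ℝ) ^ (1 / p) / (1 / p - 1) ≤ y) (i k : Fin 2) :
    2 ^ m ≤ ‖M 1 (Complex.I * y) i k‖ := by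
  have hα := one_div_sub_one_pos hp0 hp1
  have hy0 : 0 ≤ y := le_trans (by positivity) hy
  have hmono := strictMono_switchPoint hp0 hp1
  set s : ℕ → ℝ := fun j => y * (switchPoint p (j + 2) - switchPoint p (j + 1)) with hs
  have hs0 : ∀ j, 0 ≤ s j := fun j =>
    mul_nonneg hy0 (sub_nonneg.2 (hmono (Nat.lt_succ_self j)).le)
  have hs1 : ∀ j < 2 * m + 2, 1 ≤ s j := by
    intro j hj
    have h1 := le_switchPoint_sub hp0 hp1 j
    have h2 : ((j + 2 : ℕ) : ℝ) ^ (1 / p) ≤ ((2 * m + 3 : ℕ) : ℝ) ^ (1 / p) := by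
      refine Real.rpow_le_rpow (by positivity) ?_ (by positivity)
      exact_mod_cast (by omega : j + 2 ≤ 2 * m + 3)
    have h3 : ((j + 2 : ℕ) : ℝ) ^ (1 / p) / (1 / p - 1) ≤ y := le_trans (by gcongr) hy
    have h4 : 0 < ((j + 2 : ℕ) : ℝ) ^ (1 / p) := by positivity
    calc (1 : ℝ) = ((j + 2 : ℕ) : ℝ) ^ (1 / p) / (1 / p - 1) *
          ((1 / p - 1) / ((j + 2 : ℕ) : ℝ) ^ (1 / p)) := by
            rw [div_mul_div_cancel₀ hα.ne', div_self h4.ne']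
      _ ≤ s j := mul_le_mul h3 h1 (by positivity) hy0
  have hlim : Tendsto (fun j : ℕ => ‖M (switchPoint p (j + 1)) (Complex.I * y) i k‖) atTop
      (𝓝 ‖M 1 (Complex.I * y) i k‖) := by
    have h1 : Tendsto (fun j : ℕ => switchPoint p (j + 1)) atTop (𝓝[Icc 0 1] 1) :=
      tendsto_nhdsWithin_iff.2 ⟨tendsto_switchPoint hp0 hp1, Eventually.of_forall fun j =>
        ⟨switchPoint_nonneg hp0 hp1 j, (switchPoint_lt_one p j).le⟩⟩
    have h2 := (hc (Complex.I * y) 1 ⟨zero_le_one, le_rfl⟩).tendsto.comp h1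
    exact ((continuous_id.matrix_elem i k).tendsto _ |>.comp h2).norm
  refine ge_of_tendsto hlim ?_
  filter_upwards [eventually_ge_atTop (2 * m + 2)] with j hj
  rw [norm_entry_eq_transferProduct hp0 hp1 hc h hy0]
  exact (two_pow_le_transferProduct m hs1 i k).trans (monotone_transferProduct hs0 i k hj)

theorem le_growthOrder_of_two_pow_le {f : ℂ → ℂ} {p c : ℝ} (hp : 0 < p) (hc : 0 < c)
    (h : ∀ (m : ℕ) (y : ℝ), ((2 * m + 3 : ℕ) : ℝ) ^ (1 / p) / c ≤ y →
      2 ^ m ≤ ‖f (Complex.I * y)‖) : (p : EReal) ≤ growthOrder f := by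
  -- Since `5 m ≥ 2 m + 3` for `m ≥ 1`, the hypothesis applies at `y m`, and `log (y m)` is affine
  -- in `log m` with slope `1 / p`.
  set y : ℕ → ℝ := fun m => (5 * m : ℝ) ^ (1 / p) / c with hy
  have hcast : Tendsto (fun m : ℕ => (m : ℝ)) atTop atTop := tendsto_natCast_atTop_atTop
  have hlog : Tendsto (fun m : ℕ => Real.log m) atTop atTop := Real.tendsto_log_atTop.comp hcast
  have hyT : Tendsto y atTop atTop :=
    ((tendsto_rpow_atTop (by positivity)).comp
      (hcast.const_mul_atTop (by norm_num : (0 : ℝ) < 5))).atTop_div_const hc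
  have hzT : Tendsto (fun m => Complex.I * (y m : ℂ)) atTop (Bornology.cobounded ℂ) := by
    rw [← tendsto_norm_atTop_iff_cobounded]
    refine (tendsto_abs_atTop_atTop.comp hyT).congr fun m => ?_
    simp
  set v : ℕ → ℝ := fun m => (Real.log m + Real.log (Real.log 2)) /
    (1 / p * Real.log m + (1 / p * Real.log 5 - Real.log c)) with hv
  have hvT : Tendsto v atTop (𝓝 p) := by
    have h1 : Tendsto (fun m : ℕ => (1 + Real.log (Real.log 2) / Real.log m) /
        (1 / p + (1 / p * Real.log 5 - Real.log c) / Real.log m)) atTop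
        (𝓝 ((1 + 0) / (1 / p + 0))) :=
      ((hlog.const_div_atTop _).const_add 1).div ((hlog.const_div_atTop _).const_add (1 / p))
        (by positivity)
    rw [add_zero, add_zero, one_div_one_div] at h1
    refine h1.congr' ?_
    filter_upwards [hlog.eventually_gt_atTop 0] with m hm
    rw [hv]
    simp only
    rw [← mul_div_mul_right _ _ hm.ne', add_mul, add_mul, div_mul_cancel₀ _ hm.ne',
      div_mul_cancel₀ _ hm.ne', one_mul]
  have hvE : Tendsto (fun m => ((v m : ℝ) : EReal)) atTop (𝓝 (p : EReal)) :=
    (continuous_coe_real_ereal.tendsto p).comp hvT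
  rw [← hvE.limsup_eq, growthOrder]
  refine le_trans (limsup_le_limsup ?_) (limsup_le_limsup_of_le hzT)
  have hlog2 : 0 < Real.log 2 := Real.log_pos (by norm_num)
  filter_upwards [eventually_ge_atTop 1, hyT.eventually_gt_atTop 1,
    (hcast.atTop_mul_const hlog2).eventually_ge_atTop 1] with m hm hym hml
  have hm0 : (0 : ℝ) < m := by exact_mod_cast hm
  simp only [EReal.coe_le_coe_iff]
  have hnorm : ‖Complex.I * (y m : ℂ)‖ = y m := by
    rw [norm_mul, Complex.norm_I, one_mul, Complex.norm_real, Real.norm_eq_abs,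
      abs_of_pos (by linarith)]
  have hden : Real.log (y m) = 1 / p * Real.log m + (1 / p * Real.log 5 - Real.log c) := by
    rw [hy]
    simp only
    rw [Real.log_div (by positivity) hc.ne', Real.log_rpow (by positivity),
      Real.log_mul (by norm_num) hm0.ne']
    ring
  have hle : 2 ^ m ≤ ‖f (Complex.I * y m)‖ := by
    refine h m (y m) ?_
    rw [hy]
    simp only
    gcongr
    have : (1 : ℝ) ≤ m := by exact_mod_cast hm
    push_cast
    linarith
  have h1 : m * Real.log 2 ≤ Real.posLog ‖f (Complex.I * y m)‖ := by
    refine le_trans ?_ (Real.posLog_le_posLog (by positivity) hle)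
    rw [Real.posLog_apply, Real.log_pow]
    exact le_max_right _ _
  have h2 : Real.log m + Real.log (Real.log 2) ≤
      Real.posLog (Real.posLog ‖f (Complex.I * y m)‖) := by
    refine le_trans ?_ (Real.posLog_le_posLog (by positivity) h1)
    rw [Real.posLog_apply, Real.log_mul hm0.ne' hlog2.ne']
    exact le_max_right _ _
  rw [hnorm, hv]
  simp only
  rw [← hden]
  exact div_le_div_of_nonneg_right h2 (Real.log_pos hym).le

theorem hasOrder_switchHamiltonian {p : ℝ} (hp0 : 0 < p) (hp1 : p < 1) :
    HasOrder (switchHamiltonian p) 1 p := by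
  obtain ⟨M, hc, h⟩ := exists_eq_one_add_integral (aestronglyMeasurable_switchHamiltonian p)
    (norm_switchHamiltonian_le p) 1
  have hM : IsMonodromyMatrix (switchHamiltonian p) 1 M :=
    isMonodromyMatrix_of_eq_one_add_integral zero_le_one
      (aestronglyMeasurable_switchHamiltonian p) (norm_switchHamiltonian_le p) hc h
  refine ⟨M, hM, fun i k => le_antisymm ?_ ?_⟩
  · have hlim : Tendsto (fun d : ℝ => (d : EReal)) (𝓝[>] p) (𝓝 (p : EReal)) :=
      (continuous_coe_real_ereal.tendsto p).mono_left nhdsWithin_le_nhds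
    refine ge_of_tendsto hlim ?_
    filter_upwards [Ioo_mem_nhdsGT hp1] with d hd
    exact (approximable_switchHamiltonian hp0 hp1 hd.1).growthOrder_le
      (isCanonicalSystem_switchHamiltonian p) (hp0.trans hd.1) hd.2 hM i k
  · exact le_growthOrder_of_two_pow_le hp0 (one_div_sub_one_pos hp0 hp1) fun m y hy =>
      two_pow_le_norm_entry hp0 hp1 hc h m hy i k

end CanonicalSystem

theorem theorem1 :
    (∀ (H : ℝ → CanonicalSystem.Mat2) (L d : ℝ),
      CanonicalSystem.IsCanonicalSystem H L → 0 < d → d < 1 →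
      CanonicalSystem.Approximable H L d →
      ∀ M : ℝ → ℂ → CanonicalSystem.Mat2, CanonicalSystem.IsMonodromyMatrix H L M →
        (∃ K : ℝ, 0 < K ∧ ∀ z : ℂ, ‖M L z‖ ≤ Real.exp (K * ‖z‖ ^ d)) ∧
        ∀ i k : Fin 2, CanonicalSystem.growthOrder (fun z => M L z i k) ≤ (d : EReal)) ∧
    (∀ p : ℝ, 0 < p → p < 1 →
      ∃ (H : ℝ → CanonicalSystem.Mat2) (L : ℝ),
        (L = 1 ∧ H = CanonicalSystem.switchHamiltonian p) ∧
        CanonicalSystem.IsCanonicalSystem H L ∧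
        CanonicalSystem.IsTraceNormed H L ∧
        CanonicalSystem.HasOrder H L p ∧
        ∀ ε : ℝ, 0 < ε → CanonicalSystem.Approximable H L (p + ε)) := by
  refine ⟨fun H L d hH hd0 hd1 hA M hM => ⟨hA.exists_norm_monodromyMatrix_le hH hd1 hM,
    hA.growthOrder_le hH hd0 hd1 hM⟩, fun p hp0 hp1 => ⟨_, 1, ⟨rfl, rfl⟩,
    CanonicalSystem.isCanonicalSystem_switchHamiltonian p,
    CanonicalSystem.isTraceNormed_switchHamiltonian p,
    CanonicalSystem.hasOrder_switchHamiltonian hp0 hp1, fun ε hε =>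
    CanonicalSystem.approximable_switchHamiltonian hp0 hp1 (by linarith)⟩⟩
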